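/- Let $\mathbb K=\mathbb R$ or $\mathbb C$, let $E$ be a locally convex Hausdorff space over $\mathbb K$ with a fundamental system of seminorms $(p_\alpha)_{\alpha\in\mathfrak A}$, let $\Omega\subset\mathbb R^d$ be open, and let $(M_p)_{p\in\mathbb N_0}$ be a sequence of positive real numbers. Let $\mathcal C^\infty(\Omega,E)$ be the space of infinitely continuously partially differentiable functions $\Omega\to E$. For $f\in\mathcal C^\infty(\Omega,E)$, a compact set $K\subset\Omega$, $\alpha\in\mathfrak A$ and a sequence of positive numbers $(N_n)_{n\in\mathbb N_0}$ put $$|f|_{K,N,\alpha}:=\sup_{x\in K,\ \beta\in\mathbb N_0^d}\frac{p_\alpha\big(\partial^\beta f(x)\big)}{N_{|\beta|}M_{|\beta|}}.$$ The Beurling class $\mathcal E^{(M_p)}(\Omega,E)$ is the space of all $f\in\mathcal C^\infty(\Omega,E)$ such that $|f|_{K,N,\alpha}<\infty$ for all compact $K\subset\Omega$, all $\alpha\in\mathfrak A$ and all $N$ of the form $N_n=h^n$ with $h>0$. The Roumieu class $\mathcal E^{\{M_p\}}(\Omega,E)$ is the space of all $f\in\mathcal C^\infty(\Omega,E)$ such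 that $|f|_{K,N,\alpha}<\infty$ for all compact $K\subset\Omega$, all $\alpha\in\mathfrak A$ and all $N$ of the form $N_n=h_1\cdots h_n$ (so $N_0=1$) with $0<h_1\le h_2\le\dots$ and $h_k\to\infty$. Both spaces carry the locally convex topology generated by these seminorms; write $\mathcal E^{*}(\Omega):=\mathcal E^{*}(\Omega,\mathbb K)$, where $\mathbb K$ has the seminorm $|\cdot|$. For a locally convex Hausdorff space $F$ let $F'_\kappa$ be its dual with the topology of uniform convergence on the absolutely convex compact subsets of $F$, and let $F\varepsilon E:=L_e(F'_\kappa,E)$ be the space of continuous linear maps $F'_\kappa\to E$ with the topology of uniform convergence on the equicontinuous subsets of $F'$. We write $\mathcal E^{*}(\Omega,E)\cong\mathcal E^{*}(\Omega)\varepsilon E$ if the map $S\colon u\mapsto\big(x\mapsto u(\delta_x)\big)$, where $\delta_x(f)=f(x)$, is a linear topological isomorphism from $\mathcal E^{*}(\Omega)\varepsilon E$ onto $\mathcal E^{*}(\Omega,E)$. Consider the conditions - (M.0) $M_0=M_1=1$; - (M.1) $M_p^2\le M_{p-1}M_{p+1}$ for all $p\ge1$; - (M.2)' there are $A,C>0$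 with $M_{p+1}\le AC^{p+1}M_p$ for all $p\ge0$; - (M.3)' $\sum_{p=1}^\infty M_{p-1}/M_p<\infty$. A space is called semi-Montel if each of its bounded subsets is relatively compact. Then: a) $\mathcal E^{(M_p)}(\Omega,E)\cong\mathcal E^{(M_p)}(\Omega)\varepsilon E$ if $E$ is complete or semi-Montel. b) $\mathcal E^{\{M_p\}}(\Omega,E)\cong\mathcal E^{\{M_p\}}(\Omega)\varepsilon E$ if $E$ is complete or semi-Montel and, in both cases, $(M_p)$ satisfies (M.1) and (M.3)'. c) $\mathcal E^{(M_p)}(\Omega,E)\cong\mathcal E^{(M_p)}(\Omega)\varepsilon E$ and $\mathcal E^{\{M_p\}}(\Omega,E)\cong\mathcal E^{\{M_p\}}(\Omega)\varepsilon E$ if $E$ is sequentially complete and $(M_p)$ satisfies (M.0), (M.1), (M.2)' and (M.3)'. -/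

import Mathlib

open Filter Topology TopologicalSpace
open scoped NNReal

set_option linter.unusedSectionVars false

noncomputable section

namespace Ultra

/-! ### Partial derivatives of functions with values in a locally convex space -/

section Derivatives

variable (𝕜 : Type*) [RCLike 𝕜] {E : Type*} [AddCommGroup E] [Module 𝕜 E]
variable {d : ℕ} {Ω : Opens (EuclideanSpace ℝ (Fin d))}

/-- The function `f : Ω → E`, extended by zero. As `Ω` is open, only the values in `Ω` matter in
the limits below. -/
def zeroExt (f : Ω → E) : EuclideanSpace ℝ (Fin d) → E :=
  Function.extend Subtype.val f 0

/-- The difference quotient `(f (x + h eₙ) - f x) / h`. -/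
def diffQuot (n : Fin d) (f : Ω → E) (x : Ω) (h : ℝ) : E :=
  ((h : 𝕜)⁻¹) •
    (zeroExt f ((x : EuclideanSpace ℝ (Fin d)) + h • EuclideanSpace.single n (1 : ℝ)) - f x)

variable [TopologicalSpace E]

/-- `v` is the `n`-th partial derivative of `f` at `x`. -/
def HasPartialAt (n : Fin d) (f : Ω → E) (x : Ω) (v : E) : Prop :=
  Tendsto (diffQuot 𝕜 n f x) (𝓝[≠] 0) (𝓝 v)

/-- The `n`-th partial derivative of `f` (with an arbitrary value where it does not exist). -/
def partialDeriv (n : Fin d) (f : Ω → E) : Ω → E := fun x =>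
  @limUnder _ _ _ ⟨0⟩ (𝓝[≠] (0 : ℝ)) (diffQuot 𝕜 n f x)

/-- `f` is `k` times continuously partially differentiable on `Ω`. -/
def IsCk : ℕ → (Ω → E) → Prop
  | 0, f => Continuous f
  | k + 1, f => ∀ n : Fin d, (∀ x, ∃ v, HasPartialAt 𝕜 n f x v) ∧
      Continuous (partialDeriv 𝕜 n f) ∧ IsCk k (partialDeriv 𝕜 n f)

/-- `f` is infinitely continuously partially differentiable on `Ω`. -/
def IsSmooth (f : Ω → E) : Prop := ∀ k, IsCk 𝕜 k f

/-- `∂^β f = ∂₁^{β₁} ⋯ ∂_d^{β_d} f`. -/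
def iterPartial (β : Fin d → ℕ) (f : Ω → E) : Ω → E :=
  (List.finRange d).foldr (fun n g => (partialDeriv 𝕜 n)^[β n] g) f

variable {𝕜}

theorem zeroExt_add (f g : Ω → E) : zeroExt (f + g) = zeroExt f + zeroExt g := by
  have := Function.extend_add (Subtype.val : Ω → EuclideanSpace ℝ (Fin d)) f g 0 0
  simpa [zeroExt] using this

theorem zeroExt_smul (c : 𝕜) (f : Ω → E) : zeroExt (c • f) = c • zeroExt f := by
  have := Function.extend_smul c (Subtype.val : Ω → EuclideanSpace ℝ (Fin d)) f 0
  simpa [zeroExt] using this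

theorem HasPartialAt.add [IsTopologicalAddGroup E] {n : Fin d} {f g : Ω → E} {x : Ω} {v w : E}
    (hf : HasPartialAt 𝕜 n f x v) (hg : HasPartialAt 𝕜 n g x w) :
    HasPartialAt 𝕜 n (f + g) x (v + w) := by
  unfold HasPartialAt at *
  refine (hf.add hg).congr fun h => ?_
  simp only [diffQuot, zeroExt_add, Pi.add_apply, ← smul_add]
  congr 1
  abel

theorem HasPartialAt.smul [ContinuousConstSMul 𝕜 E] {n : Fin d} {f : Ω → E} {x : Ω} {v : E}
    (c : 𝕜) (hf : HasPartialAt 𝕜 n f x v) : HasPartialAt 𝕜 n (c • f) x (c • v) := by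
  unfold HasPartialAt at *
  refine (hf.const_smul c).congr fun h => ?_
  simp only [diffQuot, zeroExt_smul, Pi.smul_apply, ← smul_sub]
  rw [smul_comm]

theorem HasPartialAt.eq [T2Space E] {n : Fin d} {f : Ω → E} {x : Ω} {v : E}
    (hf : HasPartialAt 𝕜 n f x v) : partialDeriv 𝕜 n f x = v :=
  Tendsto.limUnder_eq hf

theorem IsSmooth.partialDeriv {f : Ω → E} (hf : IsSmooth 𝕜 f) (n : Fin d) :
    IsSmooth 𝕜 (partialDeriv 𝕜 n f) := fun k => (hf (k + 1) n).2.2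

theorem iterPartial_zero_left (f : Ω → E) : iterPartial 𝕜 (0 : Fin d → ℕ) f = f := by
  unfold iterPartial
  induction List.finRange d with
  | nil => rfl
  | cons a l ih => simp

variable [T2Space E] [IsTopologicalAddGroup E] [ContinuousConstSMul 𝕜 E]

theorem partialDeriv_add {n : Fin d} {f g : Ω → E} (hf : ∀ x, ∃ v, HasPartialAt 𝕜 n f x v)
    (hg : ∀ x, ∃ v, HasPartialAt 𝕜 n g x v) :
    partialDeriv 𝕜 n (f + g) = partialDeriv 𝕜 n f + partialDeriv 𝕜 n g := by
  funext x
  obtain ⟨v, hv⟩ := hf x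
  obtain ⟨w, hw⟩ := hg x
  rw [Pi.add_apply, hv.eq, hw.eq, (hv.add hw).eq]

theorem partialDeriv_smul {n : Fin d} {f : Ω → E} (c : 𝕜)
    (hf : ∀ x, ∃ v, HasPartialAt 𝕜 n f x v) :
    partialDeriv 𝕜 n (c • f) = c • partialDeriv 𝕜 n f := by
  funext x
  obtain ⟨v, hv⟩ := hf x
  rw [Pi.smul_apply, hv.eq, (hv.smul c).eq]

theorem IsCk.add {k : ℕ} {f g : Ω → E} (hf : IsCk 𝕜 k f) (hg : IsCk 𝕜 k g) :
    IsCk 𝕜 k (f + g) := by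
  induction k generalizing f g with
  | zero => exact Continuous.add hf hg
  | succ k ih =>
    intro n
    obtain ⟨h1, h2, h3⟩ := hf n
    obtain ⟨h1', h2', h3'⟩ := hg n
    rw [partialDeriv_add h1 h1']
    refine ⟨fun x => ?_, h2.add h2', ih h3 h3'⟩
    obtain ⟨v, hv⟩ := h1 x
    obtain ⟨w, hw⟩ := h1' x
    exact ⟨_, hv.add hw⟩

theorem IsCk.smul {k : ℕ} {f : Ω → E} (c : 𝕜) (hf : IsCk 𝕜 k f) : IsCk 𝕜 k (c • f) := by
  induction k generalizing f with
  | zero => exact Continuous.const_smul hf c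
  | succ k ih =>
    intro n
    obtain ⟨h1, h2, h3⟩ := hf n
    rw [partialDeriv_smul c h1]
    refine ⟨fun x => ?_, h2.const_smul c, ih h3⟩
    obtain ⟨v, hv⟩ := h1 x
    exact ⟨_, hv.smul c⟩

theorem IsSmooth.add {f g : Ω → E} (hf : IsSmooth 𝕜 f) (hg : IsSmooth 𝕜 g) :
    IsSmooth 𝕜 (f + g) := fun k => (hf k).add (hg k)

theorem IsSmooth.smul {f : Ω → E} (c : 𝕜) (hf : IsSmooth 𝕜 f) : IsSmooth 𝕜 (c • f) :=
  fun k => (hf k).smul c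

theorem isSmooth_zero : IsSmooth 𝕜 (0 : Ω → E) := by
  have h0 : ∀ (n : Fin d) (x : Ω), HasPartialAt 𝕜 n (0 : Ω → E) x 0 := by
    intro n x
    have h : diffQuot 𝕜 n (0 : Ω → E) x = fun _ => 0 := by
      funext h
      have := zeroExt_smul (0 : 𝕜) (0 : Ω → E)
      simp only [zero_smul] at this
      simp [diffQuot, this]
    rw [HasPartialAt, h]
    exact tendsto_const_nhds
  have h1 : ∀ n : Fin d, partialDeriv 𝕜 n (0 : Ω → E) = 0 := fun n => funext fun x => (h0 n x).eq
  intro k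
  induction k with
  | zero => exact continuous_const
  | succ k ih =>
    intro n
    rw [h1]
    exact ⟨fun x => ⟨0, h0 n x⟩, continuous_const, ih⟩

theorem iter_aux (n : Fin d) (m : ℕ) {f : Ω → E} (hf : IsSmooth 𝕜 f) :
    IsSmooth 𝕜 ((Ultra.partialDeriv 𝕜 n)^[m] f) ∧
    (∀ c : 𝕜, (Ultra.partialDeriv 𝕜 n)^[m] (c • f) = c • (Ultra.partialDeriv 𝕜 n)^[m] f) ∧
    (∀ g : Ω → E, IsSmooth 𝕜 g → (Ultra.partialDeriv 𝕜 n)^[m] (f + g) =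
      (Ultra.partialDeriv 𝕜 n)^[m] f + (Ultra.partialDeriv 𝕜 n)^[m] g) := by
  induction m generalizing f with
  | zero => exact ⟨hf, fun _ => rfl, fun _ _ => rfl⟩
  | succ m ih =>
    obtain ⟨h1, h2, h3⟩ := ih (hf.partialDeriv n)
    simp only [Function.iterate_succ, Function.comp_apply]
    refine ⟨h1, fun c => ?_, fun g hg => ?_⟩
    · rw [partialDeriv_smul c (hf 1 n).1, h2]
    · rw [partialDeriv_add (hf 1 n).1 (hg 1 n).1, h3 _ (hg.partialDeriv n)]

theorem foldr_aux (β : Fin d → ℕ) (l : List (Fin d)) {f : Ω → E} (hf : IsSmooth 𝕜 f) :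
    IsSmooth 𝕜 (l.foldr (fun n g => (Ultra.partialDeriv 𝕜 n)^[β n] g) f) ∧
    (∀ c : 𝕜, l.foldr (fun n g => (Ultra.partialDeriv 𝕜 n)^[β n] g) (c • f) =
      c • l.foldr (fun n g => (Ultra.partialDeriv 𝕜 n)^[β n] g) f) ∧
    (∀ g : Ω → E, IsSmooth 𝕜 g →
      l.foldr (fun n g => (Ultra.partialDeriv 𝕜 n)^[β n] g) (f + g) =
      l.foldr (fun n g => (Ultra.partialDeriv 𝕜 n)^[β n] g) f +
      l.foldr (fun n g => (Ultra.partialDeriv 𝕜 n)^[β n] g) g) := by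
  induction l generalizing f with
  | nil => exact ⟨hf, fun _ => rfl, fun _ _ => rfl⟩
  | cons a l ih =>
    obtain ⟨h1, h2, h3⟩ := ih hf
    obtain ⟨k1, k2, k3⟩ := iter_aux a (β a) h1
    simp only [List.foldr_cons]
    refine ⟨k1, fun c => ?_, fun g hg => ?_⟩
    · rw [h2, k2]
    · rw [h3 g hg, k3 _ (ih hg).1]

theorem iterPartial_add (β : Fin d → ℕ) {f g : Ω → E} (hf : IsSmooth 𝕜 f) (hg : IsSmooth 𝕜 g) :
    iterPartial 𝕜 β (f + g) = iterPartial 𝕜 β f + iterPartial 𝕜 β g :=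
  (foldr_aux β _ hf).2.2 g hg

theorem iterPartial_smul (β : Fin d → ℕ) {f : Ω → E} (c : 𝕜) (hf : IsSmooth 𝕜 f) :
    iterPartial 𝕜 β (c • f) = c • iterPartial 𝕜 β f :=
  (foldr_aux β _ hf).2.1 c

theorem iterPartial_zero_right (β : Fin d → ℕ) : iterPartial 𝕜 β (0 : Ω → E) = 0 := by
  have := iterPartial_smul β (0 : 𝕜) (isSmooth_zero (𝕜 := 𝕜) (E := E) (Ω := Ω))
  simpa using this

end Derivatives

/-! ### Weighted spaces of smooth functions -/

section Spaces

variable (𝕜 : Type*) [RCLike 𝕜] {E : Type*} [AddCommGroup E] [Module 𝕜 E] [TopologicalSpace E]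
  [T2Space E] [IsTopologicalAddGroup E] [ContinuousConstSMul 𝕜 E]
  {d : ℕ} (Ω : Opens (EuclideanSpace ℝ (Fin d))) {J : Type*} (ν : J → ℕ → ℝ≥0)
  {A : Type*} (p : SeminormFamily 𝕜 E A)

/-- The values `p_α (∂^β f (x)) ν_j(|β|)` for `x ∈ K` and all multi-indices `β`. -/
def weightedVal (f : Ω → E) (K : Compacts Ω) (j : J) (α : A)
    (z : {x : Ω // x ∈ K} × (Fin d → ℕ)) : ℝ :=
  p α (iterPartial 𝕜 z.2 f z.1.1) * (ν j (∑ n, z.2 n) : ℝ)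

/-- The smooth functions `f : Ω → E` such that
`|f|_{(K, j), α} = sup {p_α (∂^β f (x)) ν_j(|β|) | x ∈ K, β}` is finite for all compact `K ⊆ Ω`,
all `j` and all `α`. -/
def weightedSubmodule : Submodule 𝕜 (Ω → E) where
  carrier := {f | IsSmooth 𝕜 f ∧
    ∀ (K : Compacts Ω) (j : J) (α : A), BddAbove (Set.range (weightedVal 𝕜 Ω ν p f K j α))}
  zero_mem' := by
    refine ⟨isSmooth_zero, fun K j α => ⟨0, ?_⟩⟩
    rintro _ ⟨z, rfl⟩
    simp [weightedVal, iterPartial_zero_right]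
  add_mem' := by
    rintro f g ⟨hf, hf'⟩ ⟨hg, hg'⟩
    refine ⟨hf.add hg, fun K j α => ?_⟩
    obtain ⟨a, ha⟩ := hf' K j α
    obtain ⟨b, hb⟩ := hg' K j α
    refine ⟨a + b, ?_⟩
    rintro _ ⟨z, rfl⟩
    have h1 := ha ⟨z, rfl⟩
    have h2 := hb ⟨z, rfl⟩
    simp only [weightedVal] at h1 h2 ⊢
    rw [iterPartial_add _ hf hg, Pi.add_apply]
    refine le_trans ?_ (add_le_add h1 h2)
    rw [← add_mul]
    exact mul_le_mul_of_nonneg_right (map_add_le_add _ _ _) (NNReal.coe_nonneg _)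
  smul_mem' := by
    rintro c f ⟨hf, hf'⟩
    refine ⟨hf.smul c, fun K j α => ?_⟩
    obtain ⟨a, ha⟩ := hf' K j α
    refine ⟨‖c‖ * a, ?_⟩
    rintro _ ⟨z, rfl⟩
    have h1 := ha ⟨z, rfl⟩
    simp only [weightedVal] at h1 ⊢
    rw [iterPartial_smul _ c hf, Pi.smul_apply, map_smul_eq_mul, mul_assoc]
    exact mul_le_mul_of_nonneg_left h1 (norm_nonneg c)

/-- The space of weighted smooth functions. This is a type of its own, so that it carries the
topology of its seminorms and not the topology of pointwise convergence. -/
def WeightedSpace : Type _ := weightedSubmodule 𝕜 Ω ν p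

namespace WeightedSpace

instance : AddCommGroup (WeightedSpace 𝕜 Ω ν p) :=
  inferInstanceAs (AddCommGroup (weightedSubmodule 𝕜 Ω ν p))

instance : Module 𝕜 (WeightedSpace 𝕜 Ω ν p) :=
  inferInstanceAs (Module 𝕜 (weightedSubmodule 𝕜 Ω ν p))

instance : CoeFun (WeightedSpace 𝕜 Ω ν p) (fun _ => Ω → E) := ⟨fun f => f.1⟩

/-- The seminorm `|f|_{(K, j), α} = sup {p_α (∂^β f (x)) ν_j(|β|) | x ∈ K, β}`. -/
def seminorm (K : Compacts Ω) (j : J) (α : A) : Seminorm 𝕜 (WeightedSpace 𝕜 Ω ν p) :=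
  Seminorm.of (fun f => ⨆ z, weightedVal 𝕜 Ω ν p f.1 K j α z)
    (by
      intro f g
      have nn : ∀ (f : WeightedSpace 𝕜 Ω ν p) z, 0 ≤ weightedVal 𝕜 Ω ν p f.1 K j α z :=
        fun f z => mul_nonneg (apply_nonneg _ _) (NNReal.coe_nonneg _)
      refine Real.iSup_le (fun z => ?_) (add_nonneg (Real.iSup_nonneg (nn f))
        (Real.iSup_nonneg (nn g)))
      refine le_trans ?_ (add_le_add (le_ciSup (f.2.2 K j α) z) (le_ciSup (g.2.2 K j α) z))
      have : (f + g).1 = f.1 + g.1 := rfl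
      simp only [weightedVal, this]
      rw [iterPartial_add _ f.2.1 g.2.1, Pi.add_apply, ← add_mul]
      exact mul_le_mul_of_nonneg_right (map_add_le_add _ _ _) (NNReal.coe_nonneg _))
    (by
      intro c f
      have : (c • f).1 = c • f.1 := rfl
      rw [Real.mul_iSup_of_nonneg (norm_nonneg c)]
      congr 1
      funext z
      simp only [weightedVal, this]
      rw [iterPartial_smul _ c f.2.1, Pi.smul_apply, map_smul_eq_mul, mul_assoc])

/-- The family of all the seminorms `|·|_{(K, j), α}`. -/
def seminormFamily : SeminormFamily 𝕜 (WeightedSpace 𝕜 Ω ν p) (Compacts Ω × J × A) :=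
  fun i => seminorm 𝕜 Ω ν p i.1 i.2.1 i.2.2

/-- The locally convex topology generated by the seminorms `|·|_{(K, j), α}`. -/
instance : TopologicalSpace (WeightedSpace 𝕜 Ω ν p) :=
  (seminormFamily 𝕜 Ω ν p).moduleFilterBasis.topology

theorem withSeminorms : WithSeminorms (seminormFamily 𝕜 Ω ν p) := ⟨rfl⟩

instance : IsTopologicalAddGroup (WeightedSpace 𝕜 Ω ν p) :=
  (withSeminorms 𝕜 Ω ν p).topologicalAddGroup

instance : ContinuousSMul 𝕜 (WeightedSpace 𝕜 Ω ν p) :=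
  (withSeminorms 𝕜 Ω ν p).continuousSMul

end WeightedSpace

end Spaces

/-! ### The `ε`-product -/

section EpsilonProduct

variable (𝕜 : Type*) [RCLike 𝕜] (F : Type*) [AddCommGroup F] [Module 𝕜 F] [TopologicalSpace F]

/-- Absolutely convex sets. -/
def IsAbsConvex {F : Type*} [AddCommGroup F] [Module 𝕜 F] (K : Set F) : Prop :=
  ∀ x ∈ K, ∀ y ∈ K, ∀ a b : 𝕜, ‖a‖ + ‖b‖ ≤ 1 → a • x + b • y ∈ K

/-- `F'_κ`: the dual of `F` with the topology of uniform convergence on the absolutely convex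
compact subsets of `F`. -/
abbrev DualKappa : Type _ :=
  UniformConvergenceCLM (RingHom.id 𝕜) 𝕜 {K : Set F | IsAbsConvex 𝕜 K ∧ IsCompact K}

/-- Schwartz's `ε`-product `F ε E = L_e(F'_κ, E)`: the continuous linear maps `F'_κ → E` with the
topology of uniform convergence on the equicontinuous subsets of `F'`. -/
abbrev EpsProd (E : Type*) [AddCommGroup E] [Module 𝕜 E] [TopologicalSpace E] : Type _ :=
  UniformConvergenceCLM (E := DualKappa 𝕜 F) (RingHom.id 𝕜) E
    {H : Set (DualKappa 𝕜 F) | Equicontinuous (fun (y : H) (f : F) => y.1 f)}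

end EpsilonProduct

/-! ### Point evaluations -/

section Evaluation

variable {𝕜 : Type*} [RCLike 𝕜] {d : ℕ} {Ω : Opens (EuclideanSpace ℝ (Fin d))}

variable (𝕜) in
/-- The fundamental system `{|·|}` of seminorms of the scalar field. -/
def absFamily : SeminormFamily 𝕜 𝕜 Unit := fun _ => normSeminorm 𝕜 𝕜

/-- The point evaluation `δ_x`, `f ↦ f x`, as an element of the dual of a weighted space of scalar
functions. -/
def delta {J : Type*} (ν : J → ℕ → ℝ≥0) (hν : ∃ j, 0 < ν j 0) (x : Ω) :
    DualKappa 𝕜 (WeightedSpace 𝕜 Ω ν (absFamily 𝕜)) :=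
  ContinuousLinearMap.toUniformConvergenceCLM (RingHom.id 𝕜) 𝕜 _
    { toFun := fun f => f x
      map_add' := fun _ _ => rfl
      map_smul' := fun _ _ => rfl
      cont := by
        obtain ⟨j, hj⟩ := hν
        have hj' : (0 : ℝ) < ν j 0 := hj
        let L : WeightedSpace 𝕜 Ω ν (absFamily 𝕜) →ₗ[𝕜] 𝕜 :=
          { toFun := fun f => f x, map_add' := fun _ _ => rfl, map_smul' := fun _ _ => rfl }
        have hL : Continuous L := by
          refine WithSeminorms.continuous_normedSpace_rng 𝕜 (WeightedSpace.withSeminorms 𝕜 Ω ν _) L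
            ⟨{(⟨{x}, isCompact_singleton⟩, j, ())}, (ν j 0)⁻¹, ?_⟩
          intro f
          simp only [Finset.sup_singleton]
          have h := le_ciSup (f.2.2 ⟨{x}, isCompact_singleton⟩ j ()) (⟨x, rfl⟩, 0)
          simp only [weightedVal, iterPartial_zero_left, Pi.zero_apply, Finset.sum_const_zero] at h
          have h2 : ‖f x‖ * (ν j 0 : ℝ) ≤ WeightedSpace.seminormFamily 𝕜 Ω ν (absFamily 𝕜)
            (⟨{x}, isCompact_singleton⟩, j, ()) f := h
          change ‖f x‖ ≤ ((ν j 0)⁻¹ : ℝ≥0) * _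
          rw [NNReal.coe_inv, ← div_eq_inv_mul, le_div_iff₀ hj']
          exact h2
        exact hL }

/-- The map `S : u ↦ (x ↦ u(δ_x))` is a (well-defined) topological isomorphism of the `ε`-product
of the scalar space and `E` onto the space of `E`-valued functions. -/
def IsLinearisation {J : Type*} (ν : J → ℕ → ℝ≥0) (hν : ∃ j, 0 < ν j 0)
    (Ω : Opens (EuclideanSpace ℝ (Fin d)))
    {E : Type*} [AddCommGroup E] [Module 𝕜 E] [TopologicalSpace E]
    [T2Space E] [IsTopologicalAddGroup E] [ContinuousConstSMul 𝕜 E]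
    {A : Type*} (p : SeminormFamily 𝕜 E A) : Prop :=
  ∃ S : EpsProd 𝕜 (WeightedSpace 𝕜 Ω ν (absFamily 𝕜)) E ≃L[𝕜] WeightedSpace 𝕜 Ω ν p,
    ∀ (u : EpsProd 𝕜 (WeightedSpace 𝕜 Ω ν (absFamily 𝕜)) E) (x : Ω), S u x = u (delta ν hν x)

end Evaluation

/-! ### Ultradifferentiable functions -/

/-- The index set of the Beurling class: all `h > 0`. -/
abbrev BeurlingIndex : Type := {h : ℝ≥0 // 0 < h}

/-- The index set of the Roumieu class: all sequences `0 < h₁ ≤ h₂ ≤ …` with `h_k → ∞`;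
the term with number `k + 1` is `h k`. -/
abbrev RoumieuIndex : Type :=
  {h : ℕ → ℝ≥0 // (∀ k, 0 < h k) ∧ Monotone h ∧ Tendsto h atTop atTop}

/-- The weights `1 / (h ^ n M_n)`: the space `WeightedSpace 𝕜 Ω (beurlingWeight M) p` is the space
of `E`-valued ultradifferentiable functions of class `(M_p)` of Beurling type. -/
def beurlingWeight (M : ℕ → ℝ≥0) (h : BeurlingIndex) (n : ℕ) : ℝ≥0 :=
  1 / (h.1 ^ n * M n)

/-- The weights `1 / (H_n M_n)` with `H_n = h₁ ⋯ h_n`: the space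
`WeightedSpace 𝕜 Ω (roumieuWeight M) p` is the space of `E`-valued ultradifferentiable functions of
class `{M_p}` of Roumieu type. -/
def roumieuWeight (M : ℕ → ℝ≥0) (h : RoumieuIndex) (n : ℕ) : ℝ≥0 :=
  1 / ((∏ k ∈ Finset.range n, h.1 k) * M n)

theorem beurlingWeight_pos {M : ℕ → ℝ≥0} (hM : ∀ n, 0 < M n) : ∃ h, 0 < beurlingWeight M h 0 :=
  ⟨⟨1, one_pos⟩, by simp [beurlingWeight, hM 0]⟩

theorem roumieuWeight_pos {M : ℕ → ℝ≥0} (hM : ∀ n, 0 < M n) : ∃ h, 0 < roumieuWeight M h 0 := by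
  refine ⟨⟨fun k => (k : ℝ≥0) + 1, fun k => by positivity, fun a b hab => ?_, ?_⟩, ?_⟩
  · have : (a : ℝ≥0) ≤ b := by exact_mod_cast hab
    exact add_le_add_left this 1
  · exact tendsto_atTop_mono (fun k => le_self_add) tendsto_natCast_atTop_atTop
  · simp [roumieuWeight, hM 0]

/-- `M₀ = M₁ = 1`. -/
def CondM0 (M : ℕ → ℝ≥0) : Prop := M 0 = 1 ∧ M 1 = 1

/-- `M_p² ≤ M_{p-1} M_{p+1}` for `p ≥ 1`. -/
def CondM1 (M : ℕ → ℝ≥0) : Prop := ∀ p, 1 ≤ p → M p ^ 2 ≤ M (p - 1) * M (p + 1)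

/-- `M_{p+1} ≤ A C^{p+1} M_p` for all `p`, with some `A, C > 0`. -/
def CondM2' (M : ℕ → ℝ≥0) : Prop :=
  ∃ A C : ℝ≥0, 0 < A ∧ 0 < C ∧ ∀ p, M (p + 1) ≤ A * C ^ (p + 1) * M p

/-- `∑_{p ≥ 1} M_{p-1} / M_p < ∞`. -/
def CondM3' (M : ℕ → ℝ≥0) : Prop := Summable fun p : ℕ => M p / M (p + 1)

/-- Every bounded set is relatively compact. -/
def IsSemiMontel (𝕜 : Type*) [RCLike 𝕜] (E : Type*) [AddCommGroup E] [Module 𝕜 E]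
    [TopologicalSpace E] : Prop :=
  ∀ B : Set E, Bornology.IsVonNBounded 𝕜 B → IsCompact (closure B)

/-- Every Cauchy sequence converges. -/
def IsSeqComplete (E : Type*) [UniformSpace E] : Prop :=
  ∀ u : ℕ → E, CauchySeq u → ∃ x, Tendsto u atTop (𝓝 x)

end Ultra

end

open scoped Pointwise

set_option linter.unusedSectionVars false

noncomputable section

namespace Ultra

/-! ### Derivatives along lists of directions and continuous linear maps -/

section Composition

variable {𝕜 : Type*} [RCLike 𝕜] {E : Type*} [AddCommGroup E] [Module 𝕜 E] [TopologicalSpace E]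
variable {G : Type*} [AddCommGroup G] [Module 𝕜 G] [TopologicalSpace G]
variable {d : ℕ} {Ω : Opens (EuclideanSpace ℝ (Fin d))}

/-! Both classes are weighted spaces with three properties: the weights are positive, they are
directed, and each weight is at most `c n` times another one, with `c n → 0`. For such weights the
linearisation holds for every sequentially complete `E` (`isLinearisation_of_isSeqComplete`);
completeness and the semi-Montel property both imply sequential completeness. Write `F` for the
scalar space.

The map `x ↦ δ_x` into `F'_κ` is smooth, its derivatives being the evaluations of derivatives
(`hasPartialAt_derivEval`): the mean value inequality is uniform over compact subsets of `F`. Hence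
`S u = u ∘ δ` is smooth, and its weighted derivatives are the values of `u` on an equicontinuous
set, which makes `S` continuous. Conversely, the dual of `F'_κ` is `F` (`exists_eq_eval`), so `e ∘
u` is evaluation at the function `e ∘ S u` for each `e ∈ E'`. Taking `e` in the polar of a seminorm
bounds `u` by `S u` (`seminorm_apply_le`), whence injectivity and continuity of the inverse.

For surjectivity let `f` be `E`-valued and `y ∈ F'`. The value `u(y)` has to represent the
functional `e ↦ y(e ∘ f)` on `E'`. Because of the decay, the weighted derivatives of `f` on a
compact `K` tend to zero uniformly as the order grows, so they are values of one continuous function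
`G` on the compact metrizable space `K × ℕ∞` (`exists_continuous_range`), and the functional is
dominated by `C ‖e ∘ G‖`. Metrizability makes `C(K × ℕ∞)` separable, so the representing point is
the limit of a Cauchy sequence rather than of a net (`exists_represent`); this is why sequential
completeness suffices. Finally `u` is continuous on `F'_κ` because `{e ∘ f}`, with `e` in a polar,
is compact and absolutely convex in `F` (`isCompact_polarRange`). -/

theorem zeroExt_apply (f : Ω → E) (x : Ω) : zeroExt f (x : EuclideanSpace ℝ (Fin d)) = f x :=
  Subtype.val_injective.extend_apply f 0 x

theorem zeroExt_comp (T : E →L[𝕜] G) (f : Ω → E) : zeroExt (T ∘ f) = T ∘ zeroExt f := by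
  funext y
  simp only [zeroExt, Function.comp_apply]
  rw [Function.apply_extend T]
  congr 1
  funext x
  simp

theorem HasPartialAt.clm_comp (T : E →L[𝕜] G) {n : Fin d} {f : Ω → E} {x : Ω} {v : E}
    (h : HasPartialAt 𝕜 n f x v) : HasPartialAt 𝕜 n (T ∘ f) x (T v) := by
  refine ((T.continuous.tendsto v).comp h).congr fun t => ?_
  simp [diffQuot, zeroExt_comp]

variable (𝕜) in
/-- The iterated partial derivative `∂_{l₁} ∂_{l₂} ⋯ f` along a list of directions. -/
def listPartial (l : List (Fin d)) (f : Ω → E) : Ω → E := l.foldr (partialDeriv 𝕜) f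

@[simp] theorem listPartial_nil (f : Ω → E) : listPartial 𝕜 [] f = f := rfl

@[simp] theorem listPartial_cons (n : Fin d) (l : List (Fin d)) (f : Ω → E) :
    listPartial 𝕜 (n :: l) f = partialDeriv 𝕜 n (listPartial 𝕜 l f) := rfl

theorem listPartial_append (l l' : List (Fin d)) (f : Ω → E) :
    listPartial 𝕜 (l ++ l') f = listPartial 𝕜 l (listPartial 𝕜 l' f) :=
  List.foldr_append

theorem listPartial_replicate (k : ℕ) (n : Fin d) (f : Ω → E) :
    listPartial 𝕜 (List.replicate k n) f = (partialDeriv 𝕜 n)^[k] f := by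
  induction k with
  | zero => rfl
  | succ k ih => rw [List.replicate_succ, listPartial_cons, ih, Function.iterate_succ_apply']

/-- The ordered list of directions that belongs to a multi-index. -/
def multiList (β : Fin d → ℕ) : List (Fin d) :=
  (List.finRange d).flatMap fun n => List.replicate (β n) n

/-- Lists suit induction better than multi-indices: a direction put in front is one more derivative,
whereas `iterPartial` fixes the order of differentiation. -/
theorem iterPartial_eq_listPartial (β : Fin d → ℕ) (f : Ω → E) :
    iterPartial 𝕜 β f = listPartial 𝕜 (multiList β) f := by
  unfold iterPartial multiList
  induction List.finRange d with
  | nil => rfl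
  | cons a l ih => rw [List.foldr_cons, List.flatMap_cons, listPartial_append, ← ih,
      listPartial_replicate]

theorem perm_multiList (l : List (Fin d)) : l.Perm (multiList fun n => l.count n) := by
  classical
  rw [List.perm_iff_count]
  intro a
  rw [multiList, List.count_flatMap]
  have : (List.count a ∘ fun n => List.replicate (List.count n l) n) =
      fun n => if n = a then List.count n l else 0 := by
    funext n
    simp [List.count_replicate]
  rw [this]
  have h := List.sum_ofFn (n := d) (f := fun n => if n = a then List.count n l else 0)
  rw [List.ofFn_eq_map] at h
  rw [h]
  simp

theorem IsSmooth.listPartial {f : Ω → E} (hf : IsSmooth 𝕜 f) (l : List (Fin d)) :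
    IsSmooth 𝕜 (listPartial 𝕜 l f) := by
  induction l with
  | nil => exact hf
  | cons n l ih => exact ih.partialDeriv n

theorem IsSmooth.continuous {f : Ω → E} (hf : IsSmooth 𝕜 f) : Continuous f := hf 0

theorem IsSmooth.hasPartialAt [T2Space E] {f : Ω → E} (hf : IsSmooth 𝕜 f) (n : Fin d) (x : Ω) :
    HasPartialAt 𝕜 n f x (Ultra.partialDeriv 𝕜 n f x) := by
  obtain ⟨v, hv⟩ := (hf 1 n).1 x
  rwa [hv.eq]

theorem partialDeriv_comp [T2Space E] [T2Space G] (T : E →L[𝕜] G) {f : Ω → E}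
    (hf : IsSmooth 𝕜 f) (n : Fin d) :
    partialDeriv 𝕜 n (T ∘ f) = T ∘ partialDeriv 𝕜 n f :=
  funext fun x => ((hf.hasPartialAt n x).clm_comp T).eq

theorem IsSmooth.clm_comp [T2Space E] [T2Space G] (T : E →L[𝕜] G) {f : Ω → E}
    (hf : IsSmooth 𝕜 f) : IsSmooth 𝕜 (T ∘ f) := by
  intro k
  induction k generalizing f with
  | zero => exact T.continuous.comp hf.continuous
  | succ k ih =>
    intro n
    rw [partialDeriv_comp T hf]
    exact ⟨fun x => ⟨_, (hf.hasPartialAt n x).clm_comp T⟩,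
      T.continuous.comp (hf.partialDeriv n).continuous, ih (hf.partialDeriv n)⟩

theorem listPartial_comp [T2Space E] [T2Space G] (T : E →L[𝕜] G) {f : Ω → E}
    (hf : IsSmooth 𝕜 f) (l : List (Fin d)) :
    listPartial 𝕜 l (T ∘ f) = T ∘ listPartial 𝕜 l f := by
  induction l with
  | nil => rfl
  | cons n l ih => rw [listPartial_cons, ih, partialDeriv_comp T (hf.listPartial l),
      listPartial_cons]

theorem iterPartial_comp [T2Space E] [T2Space G] (T : E →L[𝕜] G) {f : Ω → E}
    (hf : IsSmooth 𝕜 f) (β : Fin d → ℕ) :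
    iterPartial 𝕜 β (T ∘ f) = T ∘ iterPartial 𝕜 β f := by
  simp only [iterPartial_eq_listPartial, listPartial_comp T hf]

/-- A family that is closed under partial derivatives consists of smooth functions. -/
theorem isSmooth_of_family [T2Space E] (D : List (Fin d) → Ω → E) (hc : ∀ l, Continuous (D l))
    (hD : ∀ l n x, HasPartialAt 𝕜 n (D l) x (D (n :: l) x)) (l : List (Fin d)) :
    IsSmooth 𝕜 (D l) ∧ ∀ l', listPartial 𝕜 l' (D l) = D (l' ++ l) := by
  have h1 : ∀ n l, partialDeriv 𝕜 n (D l) = D (n :: l) := fun n l => funext fun x => (hD l n x).eq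
  refine ⟨fun k => ?_, fun l' => ?_⟩
  · induction k generalizing l with
    | zero => exact hc l
    | succ k ih =>
      intro n
      rw [h1]
      exact ⟨fun x => ⟨_, hD l n x⟩, hc _, ih _⟩
  · induction l' with
    | nil => rfl
    | cons n l' ih => rw [listPartial_cons, ih, h1, List.cons_append]

end Composition

/-! ### Symmetry of mixed derivatives of scalar functions -/

section Scalar

variable {𝕜 : Type*} [RCLike 𝕜] {d : ℕ} {Ω : Opens (EuclideanSpace ℝ (Fin d))}

theorem hasPartialAt_iff_hasDerivAt {n : Fin d} {f : Ω → 𝕜} {x : Ω} {v : 𝕜} :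
    HasPartialAt 𝕜 n f x v ↔ HasDerivAt (fun t : ℝ => zeroExt f
      ((x : EuclideanSpace ℝ (Fin d)) + t • EuclideanSpace.single n (1 : ℝ))) v 0 := by
  rw [hasDerivAt_iff_tendsto_slope_zero, HasPartialAt]
  refine tendsto_congr fun t => ?_
  simp only [diffQuot, zero_add, zero_smul, add_zero, zeroExt_apply, RCLike.real_smul_eq_coe_mul,
    smul_eq_mul, RCLike.ofReal_inv]

theorem IsSmooth.hasDerivAt {f : Ω → 𝕜} (hf : IsSmooth 𝕜 f) (n : Fin d)
    (y : EuclideanSpace ℝ (Fin d)) (t : ℝ)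
    (hy : y + t • EuclideanSpace.single n (1 : ℝ) ∈ Ω) :
    HasDerivAt (fun t : ℝ => zeroExt f (y + t • EuclideanSpace.single n (1 : ℝ)))
      (zeroExt (Ultra.partialDeriv 𝕜 n f) (y + t • EuclideanSpace.single n (1 : ℝ))) t := by
  have h := hasPartialAt_iff_hasDerivAt.1 (hf.hasPartialAt n ⟨_, hy⟩)
  rw [← zeroExt_apply (Ultra.partialDeriv 𝕜 n f)] at h
  have h' : HasDerivAt (fun s : ℝ => s - t) 1 t := (hasDerivAt_id t).sub_const t
  have h0 : t - t = 0 := sub_self t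
  rw [← h0] at h
  have := HasDerivAt.scomp (h := fun s : ℝ => s - t) t h h'
  rw [one_smul] at this
  refine this.congr_of_eventuallyEq (Eventually.of_forall fun s => ?_)
  simp only [Function.comp_apply]
  congr 1
  rw [sub_smul]
  abel

theorem continuousAt_zeroExt {f : Ω → 𝕜} (hf : Continuous f) (x : Ω) :
    ContinuousAt (zeroExt f) (x : EuclideanSpace ℝ (Fin d)) := by
  rw [ContinuousAt, ← map_nhds_subtype_coe_eq_nhds x.2 (Ω.isOpen.mem_nhds x.2), tendsto_map'_iff,
    zeroExt_apply]
  refine (hf.tendsto x).congr fun y => (zeroExt_apply f y).symm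

/-- The mixed derivative as a limit of second differences. -/
theorem tendsto_secondDifference {E : Type*} [NormedAddCommGroup E] [NormedSpace ℝ E]
    {F G H : ℝ → ℝ → E}
    (hF : ∀ᶠ q : ℝ × ℝ in 𝓝 (0, 0), HasDerivAt (fun a => F a q.2) (G q.1 q.2) q.1)
    (hG : ∀ᶠ q : ℝ × ℝ in 𝓝 (0, 0), HasDerivAt (fun b => G q.1 b) (H q.1 q.2) q.2)
    (hH : ContinuousAt (fun q : ℝ × ℝ => H q.1 q.2) (0, 0)) :
    Tendsto (fun s : ℝ => (s ^ 2)⁻¹ • (F s s - F s 0 - F 0 s + F 0 0)) (𝓝[>] 0)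
      (𝓝 (H 0 0)) := by
  rw [Metric.tendsto_nhds]
  intro ε hε
  have hH' : ∀ᶠ q : ℝ × ℝ in 𝓝 (0, 0), ‖H q.1 q.2 - H 0 0‖ < ε / 2 := by
    have := Metric.tendsto_nhds.1 hH (ε / 2) (half_pos hε)
    simpa [dist_eq_norm] using this
  obtain ⟨r, hr, hball⟩ := Metric.eventually_nhds_iff_ball.1 (hF.and (hG.and hH'))
  have hmem : ∀ a b : ℝ, 0 ≤ a → a < r → 0 ≤ b → b < r → (a, b) ∈ Metric.ball ((0 : ℝ), (0 : ℝ)) r := by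
    intro a b ha ha' hb hb'
    simp [Prod.dist_eq, abs_of_nonneg ha, abs_of_nonneg hb, ha', hb']
  filter_upwards [Ioo_mem_nhdsGT hr] with s hs
  have hs0 := hs.1.le
  -- The mean value inequality is applied twice, here in the second variable and below in the first,
  -- each time after subtracting the linear term given by `H 0 0`. Only continuity of `H` at the
  -- origin is needed.
  have inner : ∀ a ∈ Set.Icc (0 : ℝ) s, ‖G a s - G a 0 - s • H 0 0‖ ≤ ε / 2 * s := by
    intro a ha
    have key := norm_image_sub_le_of_norm_deriv_le_segment' (f := fun b => G a b - b • H 0 0)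
      (f' := fun b => H a b - H 0 0) (C := ε / 2) (a := 0) (b := s)
      (fun b hb => by
        have := (hball (a, b) (hmem a b ha.1 (ha.2.trans_lt hs.2) hb.1 (hb.2.trans_lt hs.2))).2.1
        have h2 := this.sub ((hasDerivAt_id b).smul_const (H 0 0))
        rw [one_smul] at h2
        exact h2.hasDerivWithinAt)
      (fun b hb =>
        (hball (a, b) (hmem a b ha.1 (ha.2.trans_lt hs.2) hb.1 (hb.2.trans hs.2))).2.2.le)
      s (Set.right_mem_Icc.2 hs0)
    refine le_trans (le_of_eq ?_) (key.trans_eq (by ring))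
    congr 1
    simp
    abel
  have outer := norm_image_sub_le_of_norm_deriv_le_segment'
    (f := fun a => F a s - F a 0 - a • s • H 0 0)
    (f' := fun a => G a s - G a 0 - s • H 0 0) (C := ε / 2 * s) (a := 0) (b := s)
    (fun a ha => by
      have h1 := (hball (a, s) (hmem a s ha.1 (ha.2.trans_lt hs.2) hs0 hs.2)).1
      have h2 := (hball (a, 0) (hmem a 0 ha.1 (ha.2.trans_lt hs.2) le_rfl hr)).1
      have h3 := (h1.sub h2).sub ((hasDerivAt_id a).smul_const (s • H 0 0))
      rw [one_smul] at h3
      exact h3.hasDerivWithinAt)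
    (fun a ha => inner a ⟨ha.1, ha.2.le⟩) s (Set.right_mem_Icc.2 hs0)
  have hs2 : 0 < s ^ 2 := pow_pos hs.1 2
  rw [dist_eq_norm]
  have e : (s ^ 2)⁻¹ • (F s s - F s 0 - F 0 s + F 0 0) - H 0 0 =
      (s ^ 2)⁻¹ • ((F s s - F s 0 - s • s • H 0 0) - (F 0 s - F 0 0 - (0 : ℝ) • s • H 0 0)) := by
    have : H 0 0 = (s ^ 2)⁻¹ • s • s • H 0 0 := by
      rw [smul_smul, smul_smul, mul_assoc, ← pow_two, inv_mul_cancel₀ hs2.ne', one_smul]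
    conv_lhs => rw [this]
    rw [← smul_sub, zero_smul]
    congr 1
    abel
  rw [e, norm_smul, norm_inv, Real.norm_of_nonneg hs2.le, inv_mul_lt_iff₀ hs2]
  refine outer.trans_lt ?_
  have : ε / 2 * s * (s - 0) = s ^ 2 * (ε / 2) := by ring
  rw [this]
  exact mul_lt_mul_of_pos_left (half_lt_self hε) hs2

theorem IsSmooth.tendsto_secondDifference {f : Ω → 𝕜} (hf : IsSmooth 𝕜 f) (n m : Fin d) (x : Ω) :
    Tendsto (fun s : ℝ => (s ^ 2)⁻¹ •
      (zeroExt f (x + s • EuclideanSpace.single n (1 : ℝ) + s • EuclideanSpace.single m (1 : ℝ)) -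
        zeroExt f (x + s • EuclideanSpace.single n (1 : ℝ)) -
        zeroExt f (x + s • EuclideanSpace.single m (1 : ℝ)) + f x)) (𝓝[>] 0)
      (𝓝 (Ultra.partialDeriv 𝕜 m (Ultra.partialDeriv 𝕜 n f) x)) := by
  set P : ℝ × ℝ → EuclideanSpace ℝ (Fin d) := fun q =>
    x + q.1 • EuclideanSpace.single n (1 : ℝ) + q.2 • EuclideanSpace.single m (1 : ℝ) with hP
  have hPc : Continuous P := by fun_prop
  have hP0 : P (0, 0) = x := by simp [hP]
  have hmem : ∀ᶠ q in 𝓝 ((0 : ℝ), (0 : ℝ)), P q ∈ Ω := by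
    refine hPc.continuousAt.eventually_mem (Ω.isOpen.mem_nhds ?_)
    rw [hP0]
    exact x.2
  have hfn := hf.partialDeriv n
  have key := Ultra.tendsto_secondDifference
    (F := fun a b => zeroExt f (P (a, b)))
    (G := fun a b => zeroExt (Ultra.partialDeriv 𝕜 n f) (P (a, b)))
    (H := fun a b => zeroExt (Ultra.partialDeriv 𝕜 m (Ultra.partialDeriv 𝕜 n f)) (P (a, b)))
    (by
      filter_upwards [hmem] with q hq
      have e : ∀ a b : ℝ, P (a, b) = (x + b • EuclideanSpace.single m (1 : ℝ)) +
          a • EuclideanSpace.single n (1 : ℝ) := fun a b => by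
        simp only [hP]
        abel
      have := hf.hasDerivAt n (x + q.2 • EuclideanSpace.single m (1 : ℝ)) q.1
        (by rw [← e]; exact hq)
      simpa only [e] using this)
    (by
      filter_upwards [hmem] with q hq
      exact hfn.hasDerivAt m (x + q.1 • EuclideanSpace.single n (1 : ℝ)) q.2 hq)
    (by
      refine ContinuousAt.comp (x := ((0 : ℝ), (0 : ℝ))) (f := P) ?_ hPc.continuousAt
      rw [hP0]
      exact continuousAt_zeroExt (hfn.partialDeriv m).continuous x)
  simp only [hP0, zeroExt_apply] at key
  simpa [hP] using key

/-- Symmetry of the mixed partial derivatives. -/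
theorem IsSmooth.partialDeriv_comm {f : Ω → 𝕜} (hf : IsSmooth 𝕜 f) (n m : Fin d) :
    Ultra.partialDeriv 𝕜 n (Ultra.partialDeriv 𝕜 m f) =
      Ultra.partialDeriv 𝕜 m (Ultra.partialDeriv 𝕜 n f) := by
  funext x
  -- Both increments equal `s`, so the second difference is symmetric in the two directions.
  refine tendsto_nhds_unique (hf.tendsto_secondDifference m n x)
    ((hf.tendsto_secondDifference n m x).congr fun s => ?_)
  rw [add_right_comm (x : EuclideanSpace ℝ (Fin d)), sub_right_comm]

theorem IsSmooth.listPartial_perm {f : Ω → 𝕜} (hf : IsSmooth 𝕜 f) {l l' : List (Fin d)}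
    (h : l.Perm l') : Ultra.listPartial 𝕜 l f = Ultra.listPartial 𝕜 l' f := by
  induction h with
  | nil => rfl
  | cons n _ ih => rw [listPartial_cons, ih, listPartial_cons]
  | swap n m l => exact (hf.listPartial l).partialDeriv_comm m n
  | trans _ _ ih ih' => exact ih.trans ih'

/-- The seminorms see only the ordered derivatives `iterPartial`; by symmetry they control the
derivatives along all lists. -/
theorem IsSmooth.listPartial_eq_iterPartial {f : Ω → 𝕜} (hf : IsSmooth 𝕜 f) (l : List (Fin d)) :
    Ultra.listPartial 𝕜 l f = iterPartial 𝕜 (fun n => l.count n) f := by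
  rw [iterPartial_eq_listPartial]
  exact hf.listPartial_perm (perm_multiList l)

end Scalar

/-! ### Absolutely convex sets and Hahn–Banach -/

section AbsConvex

variable {𝕜 : Type*} [RCLike 𝕜] {V : Type*} [AddCommGroup V] [Module 𝕜 V]

theorem IsAbsConvex.zero_mem {K : Set V} (hK : IsAbsConvex 𝕜 K) (hne : K.Nonempty) :
    (0 : V) ∈ K := by
  obtain ⟨x, hx⟩ := hne
  simpa using hK x hx x hx 0 0 (by simp)

theorem IsAbsConvex.smul_mem {K : Set V} (hK : IsAbsConvex 𝕜 K) {x : V} (hx : x ∈ K) {a : 𝕜}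
    (ha : ‖a‖ ≤ 1) : a • x ∈ K := by
  simpa using hK x hx x hx a 0 (by simpa using ha)

theorem IsAbsConvex.image {W : Type*} [AddCommGroup W] [Module 𝕜 W] {K : Set V}
    (hK : IsAbsConvex 𝕜 K) (T : V →ₗ[𝕜] W) : IsAbsConvex 𝕜 (T '' K) := by
  rintro _ ⟨x, hx, rfl⟩ _ ⟨y, hy, rfl⟩ a b hab
  exact ⟨_, hK x hx y hy a b hab, by simp⟩

theorem IsAbsConvex.add {K L : Set V} (hK : IsAbsConvex 𝕜 K) (hL : IsAbsConvex 𝕜 L) :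
    IsAbsConvex 𝕜 (K + L) := by
  rintro _ ⟨x, hx, x', hx', rfl⟩ _ ⟨y, hy, y', hy', rfl⟩ a b hab
  refine ⟨_, hK x hx y hy a b hab, _, hL x' hx' y' hy' a b hab, ?_⟩
  simp only [smul_add]
  abel

theorem IsAbsConvex.smul {K : Set V} (hK : IsAbsConvex 𝕜 K) (c : 𝕜) : IsAbsConvex 𝕜 (c • K) := by
  rw [← Set.image_smul]
  exact hK.image (c • LinearMap.id)

theorem IsAbsConvex.convex [Module ℝ V] [IsScalarTower ℝ 𝕜 V] {K : Set V}
    (hK : IsAbsConvex 𝕜 K) : Convex ℝ K := by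
  intro x hx y hy a b ha hb hab
  have h := hK x hx y hy (a : 𝕜) (b : 𝕜) (by
    rw [RCLike.norm_ofReal, RCLike.norm_ofReal, abs_of_nonneg ha, abs_of_nonneg hb, hab])
  have e : ∀ (r : ℝ) (z : V), (r : 𝕜) • z = r • z := fun r z => by
    rw [← algebraMap_smul 𝕜 r z]
  rwa [e, e] at h

theorem isAbsConvex_closedDisc (x : V) :
    IsAbsConvex 𝕜 ((fun a : 𝕜 => a • x) '' Metric.closedBall 0 1) := by
  rintro _ ⟨a, ha, rfl⟩ _ ⟨b, hb, rfl⟩ s t hst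
  refine ⟨s * a + t * b, ?_, by simp [add_smul, mul_smul]⟩
  rw [mem_closedBall_zero_iff] at ha hb ⊢
  calc ‖s * a + t * b‖ ≤ ‖s‖ * ‖a‖ + ‖t‖ * ‖b‖ := by
        refine (norm_add_le _ _).trans ?_
        rw [norm_mul, norm_mul]
    _ ≤ ‖s‖ * 1 + ‖t‖ * 1 := by gcongr
    _ ≤ 1 := by simpa using hst

/-- Finitely many values that are dominated by an absolutely convex set are attained
approximately on it. -/
theorem mem_closure_of_forall_norm_le {ι : Type*} [Fintype ι] {K : Set V}
    (hK : IsAbsConvex 𝕜 K) (e : ι → V →ₗ[𝕜] 𝕜) (v : ι → 𝕜)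
    (h : ∀ (c : ι → 𝕜) (R : ℝ), (∀ a ∈ K, ‖∑ i, c i * e i a‖ ≤ R) → ‖∑ i, c i * v i‖ ≤ R) :
    v ∈ closure ((LinearMap.pi e) '' K) := by
  classical
  by_contra hv
  obtain ⟨f, u, hf, hu⟩ := RCLike.geometric_hahn_banach_closed_point (𝕜 := 𝕜)
    (hK.image (LinearMap.pi e)).convex.closure isClosed_closure hv
  have hfs : ∀ w : ι → 𝕜, f w = ∑ i, f (Pi.single i 1) * w i := by
    intro w
    conv_lhs => rw [← Finset.univ_sum_single w, map_sum]
    refine Finset.sum_congr rfl fun i _ => ?_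
    have : Pi.single i (w i) = w i • (Pi.single i 1 : ι → 𝕜) := by
      rw [← Pi.single_smul, smul_eq_mul, mul_one]
    rw [this, map_smul, smul_eq_mul, mul_comm]
  have key := h (fun i => f (Pi.single i 1)) u (fun a ha => by
    have e1 : ∑ i, f (Pi.single i 1) * e i a = f (LinearMap.pi e a) := (hfs _).symm
    rw [e1]
    -- Separation bounds only the real part. Rotating `a` by a scalar of modulus one, which stays in
    -- `K`, turns this into a bound of the modulus.
    obtain ⟨c, hc, hc'⟩ := RCLike.exists_norm_eq_mul_self (f (LinearMap.pi e a))
    have h1 := hf _ (subset_closure ⟨c • a, hK.smul_mem ha hc.le, rfl⟩)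
    rw [map_smul, map_smul, smul_eq_mul, ← hc', RCLike.ofReal_re] at h1
    exact h1.le)
  rw [← hfs] at key
  exact absurd (hu.trans_le ((RCLike.re_le_norm _).trans key)) (lt_irrefl _)

/-- A seminorm is attained by a linear functional below it. -/
theorem exists_seminorm_dual (q : Seminorm 𝕜 V) (z : V) :
    ∃ e : V →ₗ[𝕜] 𝕜, (∀ x, ‖e x‖ ≤ q x) ∧ ‖e z‖ = q z := by
  by_cases hz : z = 0
  · exact ⟨0, fun x => by simp, by simp [hz]⟩
  let f : Module.Dual 𝕜 (Submodule.span 𝕜 {z}) :=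
    (q z : 𝕜) • (LinearEquiv.toSpanNonzeroSingleton 𝕜 V z hz).symm.toLinearMap
  have hfc : ∀ c, f (LinearEquiv.toSpanNonzeroSingleton 𝕜 V z hz c) = (q z : 𝕜) * c := fun c => by
    change (q z : 𝕜) • (LinearEquiv.toSpanNonzeroSingleton 𝕜 V z hz).symm _ = _
    rw [LinearEquiv.symm_apply_apply, smul_eq_mul]
  have hf : ∀ x, ‖f x‖ ≤ q x := by
    intro x
    obtain ⟨c, rfl⟩ := (LinearEquiv.toSpanNonzeroSingleton 𝕜 V z hz).surjective x
    rw [hfc, norm_mul, RCLike.norm_ofReal, LinearEquiv.toSpanNonzeroSingleton_apply,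
      map_smul_eq_mul, abs_of_nonneg (apply_nonneg q z), mul_comm]
  obtain ⟨g, hg, hg'⟩ := Module.Dual.exists_extension_of_le_seminorm _ f hf
  refine ⟨g, hg', ?_⟩
  have h1 := hg (LinearEquiv.toSpanNonzeroSingleton 𝕜 V z hz 1)
  rw [hfc, LinearEquiv.toSpanNonzeroSingleton_apply, mul_one] at h1
  replace h1 : g ((1 : 𝕜) • z) = q z := h1
  rw [one_smul] at h1
  rw [h1, RCLike.norm_ofReal, abs_of_nonneg (apply_nonneg q z)]

end AbsConvex

/-! ### The dual `F'_κ`: neighbourhoods of zero, its dual, equicontinuous sets -/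

section DualKappa

variable {𝕜 : Type*} [RCLike 𝕜] {F : Type*} [AddCommGroup F] [Module 𝕜 F] [TopologicalSpace F]
  [IsTopologicalAddGroup F] [ContinuousSMul 𝕜 F]

theorem exists_absConvex_compact_mem (f : F) :
    ∃ K : Set F, (IsAbsConvex 𝕜 K ∧ IsCompact K) ∧ f ∈ K :=
  ⟨_, ⟨isAbsConvex_closedDisc f, (isCompact_closedBall (0 : 𝕜) 1).image (by fun_prop)⟩,
    1, by simp, one_smul 𝕜 f⟩

theorem sUnion_absConvex_compact :
    ⋃₀ {K : Set F | IsAbsConvex 𝕜 K ∧ IsCompact K} = Set.univ :=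
  Set.eq_univ_of_forall fun f =>
    let ⟨K, hK, hf⟩ := exists_absConvex_compact_mem (𝕜 := 𝕜) f
    ⟨K, hK, hf⟩

instance : T2Space (DualKappa 𝕜 F) :=
  UniformConvergenceCLM.t2Space _ _ _ sUnion_absConvex_compact

/-- The evaluation at a point, as a continuous linear functional on `F'_κ`. -/
def evalCLM (f : F) : DualKappa 𝕜 F →L[𝕜] 𝕜 where
  toFun y := y f
  map_add' _ _ := rfl
  map_smul' _ _ := rfl
  cont := (UniformConvergenceCLM.continuousEvalConst (RingHom.id 𝕜) 𝕜 _
    sUnion_absConvex_compact).continuous_eval_const f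

@[simp] theorem evalCLM_apply (f : F) (y : DualKappa 𝕜 F) : evalCLM f y = y f := rfl

theorem directedOn_absConvex_compact :
    DirectedOn (· ⊆ ·) {K : Set F | IsAbsConvex 𝕜 K ∧ IsCompact K} := by
  rintro K ⟨hK, hK'⟩ L ⟨hL, hL'⟩
  -- The empty set counts as absolutely convex. Nonempty ones contain zero, and so their sum
  -- contains both.
  rcases K.eq_empty_or_nonempty with rfl | hKn
  · exact ⟨L, ⟨hL, hL'⟩, Set.empty_subset _, subset_rfl⟩
  rcases L.eq_empty_or_nonempty with rfl | hLn
  · exact ⟨K, ⟨hK, hK'⟩, subset_rfl, Set.empty_subset _⟩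
  exact ⟨K + L, ⟨hK.add hL, hK'.add hL'⟩, fun x hx => ⟨x, hx, 0, hL.zero_mem hLn, add_zero x⟩,
    fun x hx => ⟨0, hK.zero_mem hKn, x, hx, zero_add x⟩⟩

theorem exists_of_mem_nhds_zero {U : Set (DualKappa 𝕜 F)} (hU : U ∈ 𝓝 0) :
    ∃ K : Set F, IsAbsConvex 𝕜 K ∧ IsCompact K ∧ K.Nonempty ∧ ∃ r > 0,
      ∀ y : DualKappa 𝕜 F, (∀ f ∈ K, ‖y f‖ < r) → y ∈ U := by
  obtain ⟨⟨K, r⟩, ⟨hK, hr⟩, h⟩ := (UniformConvergenceCLM.hasBasis_nhds_zero_of_basis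
    (RingHom.id 𝕜) 𝕜 {K : Set F | IsAbsConvex 𝕜 K ∧ IsCompact K}
    ⟨_, (exists_absConvex_compact_mem (0 : F)).choose_spec.1⟩ directedOn_absConvex_compact
    Metric.nhds_basis_ball).mem_iff.1 hU
  obtain ⟨K', hK', hK0⟩ := exists_absConvex_compact_mem (𝕜 := 𝕜) (0 : F)
  obtain ⟨L, hL, h1, h2⟩ := directedOn_absConvex_compact K hK K' hK'
  exact ⟨L, hL.1, hL.2, ⟨0, h2 hK0⟩, r, hr, fun y hy => h fun f hf => by
    simpa using hy f (h1 hf)⟩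

/-- A continuous seminorm on `F'_κ` is dominated by the supremum over an absolutely convex compact
set. -/
theorem exists_bound_of_continuous_seminorm (q : Seminorm 𝕜 (DualKappa 𝕜 F)) (hq : Continuous q) :
    ∃ K : Set F, IsAbsConvex 𝕜 K ∧ IsCompact K ∧ K.Nonempty ∧
      ∀ (y : DualKappa 𝕜 F) (R : ℝ), (∀ f ∈ K, ‖y f‖ ≤ R) → q y ≤ R := by
  have hU : {y | q y < 1} ∈ 𝓝 (0 : DualKappa 𝕜 F) :=
    (isOpen_lt hq continuous_const).mem_nhds (by simp)
  obtain ⟨K, hK, hKc, hKn, r, hr, h⟩ := exists_of_mem_nhds_zero hU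
  set c : 𝕜 := ((2 / r : ℝ) : 𝕜) with hc
  have hc0 : ‖c‖ = 2 / r := by rw [hc, RCLike.norm_ofReal, abs_of_pos (by positivity)]
  refine ⟨c • K, hK.smul c, ?_, hKn.smul_set, fun y R hR => ?_⟩
  · rw [← Set.image_smul]
    exact hKc.image (continuous_const_smul c)
  have hR' : ∀ f ∈ K, ‖y f‖ ≤ r / 2 * R := by
    intro f hf
    have := hR _ (Set.smul_mem_smul_set hf)
    rw [map_smul, norm_smul, hc0] at this
    calc ‖y f‖ = r / 2 * (2 / r * ‖y f‖) := by field_simp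
      _ ≤ _ := by gcongr
  -- `R` may be zero, so `y` is scaled by `R'⁻¹` for an arbitrary `R' > R` instead.
  refine le_of_forall_gt fun R' hRR' => ?_
  have hR0 : 0 ≤ R := by
    obtain ⟨f, hf⟩ := hKn
    exact (norm_nonneg _).trans (hR _ (Set.smul_mem_smul_set hf))
  have hR'0 : 0 < R' := hR0.trans_lt hRR'
  have h1 := h (((R'⁻¹ : ℝ) : 𝕜) • y) (fun f hf => by
    change ‖((R'⁻¹ : ℝ) : 𝕜) • y f‖ < r
    rw [norm_smul, RCLike.norm_ofReal, abs_of_pos (inv_pos.2 hR'0), inv_mul_lt_iff₀ hR'0]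
    refine (hR' f hf).trans_lt ?_
    nlinarith)
  rw [Set.mem_ofPred_eq, map_smul_eq_mul, RCLike.norm_ofReal, abs_of_pos (inv_pos.2 hR'0),
    inv_mul_lt_iff₀ hR'0, mul_one] at h1
  exact h1

/-- The dual of `F'_κ` is `F`. -/
theorem exists_eq_eval (φ : DualKappa 𝕜 F →L[𝕜] 𝕜) : ∃ f : F, ∀ y, φ y = y f := by
  obtain ⟨K, hK, hcK, hKn, hbound⟩ := exists_bound_of_continuous_seminorm
    ((normSeminorm 𝕜 𝕜).comp (φ : DualKappa 𝕜 F →ₗ[𝕜] 𝕜)) φ.continuous.norm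
  -- Compactness of `K` reduces the claim to finitely many `y`. For these the values of `φ` lie in
  -- the closure of the image of `K`, and this image is compact, hence closed.
  obtain ⟨f, -, hf⟩ := hcK.inter_iInter_nonempty (fun y : DualKappa 𝕜 F => {f : F | y f = φ y})
    (fun y => isClosed_eq (map_continuous y) continuous_const) (fun s => by
      have key := mem_closure_of_forall_norm_le hK
        (fun y : s => (y.1 : F →ₗ[𝕜] 𝕜)) (fun y => φ y.1) (fun a R hR => by
          have := hbound (∑ y : s, a y • y.1) R (fun f hf => by
            refine le_trans (le_of_eq ?_) (hR f hf)
            change ‖evalCLM f (∑ y : s, a y • y.1)‖ = _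
            simp)
          simpa [Seminorm.comp_apply] using this)
      rw [IsClosed.closure_eq] at key
      · obtain ⟨f, hf, hf'⟩ := key
        refine ⟨f, hf, Set.mem_iInter₂.2 fun y hy => congr_fun hf' ⟨y, hy⟩⟩
      · refine (hcK.image ?_).isClosed
        exact continuous_pi fun y => map_continuous y.1)
  exact ⟨f, fun y => (Set.mem_iInter.1 hf y).symm⟩

/-- This turns the topology of the `ε`-product into estimates by continuous seminorms of `F`. -/
theorem equicontinuous_iff_exists_seminorm {H : Set (DualKappa 𝕜 F)} :
    Equicontinuous (fun (y : H) (f : F) => y.1 f) ↔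
      ∃ q : Seminorm 𝕜 F, Continuous q ∧ ∀ y ∈ H, ∀ f, ‖y f‖ ≤ q f := by
  let : UniformSpace F := IsTopologicalAddGroup.rightUniformSpace F
  have : IsUniformAddGroup F := isUniformAddGroup_of_addCommGroup
  have h := ((norm_withSeminorms 𝕜 𝕜).equicontinuous_TFAE
    (fun y : H => (y.1 : F →ₗ[𝕜] 𝕜))).out 1 3
  refine h.trans ⟨fun h => ?_, fun ⟨q, hq, h⟩ _ => ⟨q, hq, fun y f => h y.1 y.2 f⟩⟩
  obtain ⟨q, hq, h⟩ := h 0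
  exact ⟨q, hq, fun y hy f => h ⟨y, hy⟩ f⟩

end DualKappa

/-! ### Smoothness of `x ↦ δ_x` as a map into `F'_κ` -/

section DerivativeEvaluation

variable {𝕜 : Type*} [RCLike 𝕜] {d : ℕ} {Ω : Opens (EuclideanSpace ℝ (Fin d))}

section Linear

variable {E : Type*} [AddCommGroup E] [Module 𝕜 E] [TopologicalSpace E]
  [T2Space E] [IsTopologicalAddGroup E] [ContinuousConstSMul 𝕜 E]

theorem listPartial_add (l : List (Fin d)) {f g : Ω → E} (hf : IsSmooth 𝕜 f)
    (hg : IsSmooth 𝕜 g) :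
    listPartial 𝕜 l (f + g) = listPartial 𝕜 l f + listPartial 𝕜 l g := by
  induction l with
  | nil => rfl
  | cons n l ih => rw [listPartial_cons, ih,
      partialDeriv_add (hf.listPartial l 1 n).1 (hg.listPartial l 1 n).1, listPartial_cons,
      listPartial_cons]

theorem listPartial_smul (l : List (Fin d)) (c : 𝕜) {f : Ω → E} (hf : IsSmooth 𝕜 f) :
    listPartial 𝕜 l (c • f) = c • listPartial 𝕜 l f := by
  induction l with
  | nil => rfl
  | cons n l ih => rw [listPartial_cons, ih, partialDeriv_smul c (hf.listPartial l 1 n).1,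
      listPartial_cons]

end Linear

variable {J : Type*} {ν : J → ℕ → ℝ≥0}

theorem norm_iterPartial_mul_le (f : WeightedSpace 𝕜 Ω ν (absFamily 𝕜)) (K : Compacts Ω) (j : J)
    {x : Ω} (hx : x ∈ K) (β : Fin d → ℕ) :
    ‖iterPartial 𝕜 β f.1 x‖ * ν j (∑ n, β n) ≤ WeightedSpace.seminorm 𝕜 Ω ν (absFamily 𝕜) K j () f :=
  le_ciSup (f.2.2 K j ()) (⟨x, hx⟩, β)

/-- Near `(f, x)`, a seminorm over a compact neighbourhood of `x` controls the change of the
function, and continuity of the derivative of `f` controls the change of the point. Joint continuity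
is what gives uniformity over compact sets of functions. -/
theorem continuous_listPartial_apply [Nonempty J] (hpos : ∀ j n, 0 < ν j n) (l : List (Fin d)) :
    Continuous fun q : WeightedSpace 𝕜 Ω ν (absFamily 𝕜) × Ω => listPartial 𝕜 l q.1.1 q.2 := by
  have : LocallyCompactSpace Ω := Ω.isOpen.locallyCompactSpace
  obtain ⟨j⟩ := ‹Nonempty J›
  rw [continuous_iff_continuousAt]
  rintro ⟨f, x⟩
  obtain ⟨K, hK, hxK⟩ := exists_compact_mem_nhds x
  set β : Fin d → ℕ := fun n => l.count n with hβ
  set w : ℝ≥0 := ν j (∑ n, β n) with hw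
  have hw0 : (0 : ℝ) < w := hpos _ _
  set q := WeightedSpace.seminorm 𝕜 Ω ν (absFamily 𝕜) ⟨K, hK⟩ j () with hq
  have hqc : Continuous q :=
    (WeightedSpace.withSeminorms 𝕜 Ω ν (absFamily 𝕜)).continuous_seminorm (⟨K, hK⟩, j, ())
  have h1 : Tendsto (fun z : WeightedSpace 𝕜 Ω ν (absFamily 𝕜) × Ω =>
      listPartial 𝕜 l (z.1 - f).1 z.2) (𝓝 (f, x)) (𝓝 0) := by
    have hlim : Tendsto (fun z : WeightedSpace 𝕜 Ω ν (absFamily 𝕜) × Ω =>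
        q (z.1 - f) / w) (𝓝 (f, x)) (𝓝 0) := by
      have : Continuous fun z : WeightedSpace 𝕜 Ω ν (absFamily 𝕜) × Ω => q (z.1 - f) / w := by
        fun_prop
      simpa using this.tendsto (f, x)
    refine squeeze_zero_norm' ?_ hlim
    have hev : ∀ᶠ z : WeightedSpace 𝕜 Ω ν (absFamily 𝕜) × Ω in 𝓝 (f, x), z.2 ∈ K :=
      continuous_snd.continuousAt.eventually_mem hxK
    filter_upwards [hev] with z hz
    rw [le_div_iff₀ hw0, (z.1 - f).2.1.listPartial_eq_iterPartial]
    exact norm_iterPartial_mul_le _ ⟨K, hK⟩ j hz β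
  have h2 : Tendsto (fun z : WeightedSpace 𝕜 Ω ν (absFamily 𝕜) × Ω =>
      listPartial 𝕜 l f.1 z.2) (𝓝 (f, x)) (𝓝 (listPartial 𝕜 l f.1 x)) :=
    ((f.2.1.listPartial l).continuous.comp continuous_snd).tendsto (f, x)
  have h3 := h1.add h2
  rw [zero_add] at h3
  refine h3.congr fun z => ?_
  have : z.1.1 = (z.1 - f).1 + f.1 := (sub_add_cancel z.1.1 f.1).symm
  conv_rhs => rw [this, listPartial_add l (z.1 - f).2.1 f.2.1]
  rfl

/-- The functional `f ↦ ∂_{l₁} ∂_{l₂} ⋯ f (x)`. -/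
def derivEval [Nonempty J] (hpos : ∀ j n, 0 < ν j n) (l : List (Fin d)) (x : Ω) :
    DualKappa 𝕜 (WeightedSpace 𝕜 Ω ν (absFamily 𝕜)) :=
  ContinuousLinearMap.toUniformConvergenceCLM (RingHom.id 𝕜) 𝕜 _
    { toFun := fun f => listPartial 𝕜 l f.1 x
      map_add' := fun f g => congr_fun (listPartial_add l f.2.1 g.2.1) x
      map_smul' := fun c f => congr_fun (listPartial_smul l c f.2.1) x
      cont := (continuous_listPartial_apply hpos l).comp (continuous_id.prodMk continuous_const) }

variable [Nonempty J] (hpos : ∀ j n, 0 < ν j n)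

theorem derivEval_apply (l : List (Fin d)) (x : Ω) (f : WeightedSpace 𝕜 Ω ν (absFamily 𝕜)) :
    derivEval hpos l x f = listPartial 𝕜 l f.1 x := rfl

theorem eventually_dist_listPartial_lt (hpos : ∀ j n, 0 < ν j n)
    {K : Set (WeightedSpace 𝕜 Ω ν (absFamily 𝕜))}
    (hK : IsCompact K) (l : List (Fin d)) (x : Ω) {ε : ℝ} (hε : 0 < ε) :
    ∀ᶠ y in 𝓝 x, ∀ f ∈ K, dist (listPartial 𝕜 l f.1 y) (listPartial 𝕜 l f.1 x) < ε := by
  have hc : Continuous (Function.uncurry fun (y : Ω) (f : WeightedSpace 𝕜 Ω ν (absFamily 𝕜)) =>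
      listPartial 𝕜 l f.1 y) := (continuous_listPartial_apply hpos l).comp continuous_swap
  obtain ⟨v, hv, h⟩ := hK.mem_uniformity_of_prod (s := Set.univ) hc.continuousOn (Set.mem_univ x)
    (Metric.dist_mem_uniformity hε)
  rw [nhdsWithin_univ] at hv
  filter_upwards [hv] with y hy f hf using h y hy f hf

theorem continuous_derivEval (l : List (Fin d)) :
    Continuous (derivEval (𝕜 := 𝕜) (Ω := Ω) hpos l) := by
  rw [continuous_iff_continuousAt]
  intro x
  refine (UniformConvergenceCLM.tendsto_iff_tendstoUniformlyOn (RingHom.id 𝕜) 𝕜 _).2 ?_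
  rintro K ⟨-, hK⟩
  rw [Metric.tendstoUniformlyOn_iff]
  intro ε hε
  filter_upwards [eventually_dist_listPartial_lt hpos hK l x hε] with y hy f hf
  rw [dist_comm]
  exact hy f hf

theorem diffQuot_comp {E G : Type*} [AddCommGroup E] [Module 𝕜 E] [TopologicalSpace E]
    [AddCommGroup G] [Module 𝕜 G] [TopologicalSpace G] (T : E →L[𝕜] G) (n : Fin d) (f : Ω → E)
    (x : Ω) (t : ℝ) : diffQuot 𝕜 n (T ∘ f) x t = T (diffQuot 𝕜 n f x t) := by
  simp [diffQuot, zeroExt_comp]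

/-- The mean value inequality for `s ↦ f (x + s eₙ) - s ∂ₙf(x)`. The error depends only on the
oscillation of `∂ₙf` along the segment, so the bound is uniform over families of functions. -/
theorem norm_diffQuot_sub_le {f : Ω → 𝕜} (hf : IsSmooth 𝕜 f) (n : Fin d) (x : Ω) {r ε : ℝ}
    (h : ∀ s : ℝ, |s| < r → ∃ y : Ω, (y : EuclideanSpace ℝ (Fin d)) =
      x + s • EuclideanSpace.single n (1 : ℝ) ∧
      ‖partialDeriv 𝕜 n f y - partialDeriv 𝕜 n f x‖ ≤ ε)
    {t : ℝ} (ht : |t| < r) (ht0 : t ≠ 0) :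
    ‖diffQuot 𝕜 n f x t - partialDeriv 𝕜 n f x‖ ≤ ε := by
  set v := partialDeriv 𝕜 n f x with hv
  set g : ℝ → 𝕜 := fun s => zeroExt f
    ((x : EuclideanSpace ℝ (Fin d)) + s • EuclideanSpace.single n (1 : ℝ)) - s • v with hg
  have hr : 0 < r := (abs_nonneg t).trans_lt ht
  have key := (convex_ball (0 : ℝ) r).norm_image_sub_le_of_norm_hasDerivWithin_le (f := g)
    (f' := fun s => zeroExt (partialDeriv 𝕜 n f)
      ((x : EuclideanSpace ℝ (Fin d)) + s • EuclideanSpace.single n (1 : ℝ)) - v) (C := ε)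
    (fun s hs => by
      rw [mem_ball_zero_iff, Real.norm_eq_abs] at hs
      obtain ⟨y, hy, -⟩ := h s hs
      have h1 := hf.hasDerivAt n x s (hy ▸ y.2)
      have h2 := h1.sub ((hasDerivAt_id s).smul_const v)
      rw [one_smul] at h2
      exact h2.hasDerivWithinAt)
    (fun s hs => by
      rw [mem_ball_zero_iff, Real.norm_eq_abs] at hs
      obtain ⟨y, hy, hy'⟩ := h s hs
      rwa [← hy, zeroExt_apply])
    (Metric.mem_ball_self hr) (y := t) (by rwa [mem_ball_zero_iff, Real.norm_eq_abs])
  have e : diffQuot 𝕜 n f x t - v = (t : 𝕜)⁻¹ * (g t - g 0) := by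
    have ht' : (t : 𝕜) ≠ 0 := by exact_mod_cast ht0
    simp only [hg, diffQuot, zero_smul, add_zero, sub_zero, zeroExt_apply, smul_eq_mul,
      RCLike.real_smul_eq_coe_mul, RCLike.ofReal_zero, zero_mul]
    field_simp
    ring
  rw [e, norm_mul, norm_inv, RCLike.norm_ofReal, inv_mul_le_iff₀ (abs_pos.2 ht0), mul_comm]
  simpa using key

/-- Convergence in `F'_κ` is uniform convergence on absolutely convex compact `K ⊆ F`, and the next
derivatives of all `f ∈ K` oscillate uniformly little near `x`. -/
theorem hasPartialAt_derivEval (l : List (Fin d)) (n : Fin d) (x : Ω) :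
    HasPartialAt 𝕜 n (derivEval (𝕜 := 𝕜) hpos l) x (derivEval hpos (n :: l) x) := by
  refine (UniformConvergenceCLM.tendsto_iff_tendstoUniformlyOn (RingHom.id 𝕜) 𝕜 _).2 ?_
  rintro K ⟨-, hK⟩
  rw [Metric.tendstoUniformlyOn_iff]
  intro ε hε
  have hev := eventually_dist_listPartial_lt hpos hK (n :: l) x (half_pos hε)
  rw [nhds_subtype_eq_comap, eventually_comap] at hev
  have hcont : Continuous fun s : ℝ =>
      (x : EuclideanSpace ℝ (Fin d)) + s • EuclideanSpace.single n (1 : ℝ) := by fun_prop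
  have hlim := hcont.tendsto 0
  simp only [zero_smul, add_zero] at hlim
  obtain ⟨r, hr, hball⟩ := Metric.eventually_nhds_iff_ball.1
    ((hlim.eventually hev).and (hlim.eventually (Ω.isOpen.mem_nhds x.2)))
  filter_upwards [nhdsWithin_le_nhds (Metric.ball_mem_nhds (0 : ℝ) hr), self_mem_nhdsWithin]
    with t ht ht0 f hf
  rw [mem_ball_zero_iff, Real.norm_eq_abs] at ht
  rw [dist_comm, dist_eq_norm]
  have e1 : (diffQuot 𝕜 n (derivEval (𝕜 := 𝕜) hpos l) x t) f =
      diffQuot 𝕜 n (listPartial 𝕜 l f.1) x t :=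
    (diffQuot_comp (evalCLM f) n (derivEval (𝕜 := 𝕜) hpos l) x t).symm
  rw [e1, derivEval_apply, listPartial_cons]
  refine (norm_diffQuot_sub_le (f.2.1.listPartial l) n x (r := r) (ε := ε / 2) (fun s hs => ?_)
    ht ht0).trans_lt (half_lt_self hε)
  obtain ⟨h1, h2⟩ := hball s (by rwa [mem_ball_zero_iff, Real.norm_eq_abs])
  refine ⟨⟨_, h2⟩, rfl, ?_⟩
  have := h1 ⟨_, h2⟩ rfl f hf
  rw [dist_eq_norm] at this
  exact this.le

theorem isSmooth_derivEval (l : List (Fin d)) :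
    IsSmooth 𝕜 (derivEval (𝕜 := 𝕜) (Ω := Ω) hpos l) :=
  (isSmooth_of_family _ (continuous_derivEval hpos) (hasPartialAt_derivEval hpos) l).1

theorem iterPartial_derivEval_nil (β : Fin d → ℕ) :
    iterPartial 𝕜 β (derivEval (𝕜 := 𝕜) (Ω := Ω) hpos []) = derivEval hpos (multiList β) := by
  rw [iterPartial_eq_listPartial, (isSmooth_of_family _ (continuous_derivEval hpos)
    (hasPartialAt_derivEval hpos) []).2, List.append_nil]

end DerivativeEvaluation

/-! ### Polars of seminorms and their weak-star compactness -/

section Polar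

variable {𝕜 : Type*} [RCLike 𝕜] {E : Type*} [AddCommGroup E] [Module 𝕜 E]

/-- The set of the linear functionals that are bounded by a seminorm, with the topology of
pointwise convergence. -/
def SeminormPolar (q : Seminorm 𝕜 E) : Set (E → 𝕜) :=
  {φ | (∀ x y, φ (x + y) = φ x + φ y) ∧ (∀ (c : 𝕜) x, φ (c • x) = c * φ x) ∧ ∀ x, ‖φ x‖ ≤ q x}

/-- The theorem of Banach and Alaoglu. -/
theorem isCompact_seminormPolar (q : Seminorm 𝕜 E) : IsCompact (SeminormPolar q) := by
  have h : IsCompact (Set.univ.pi fun x : E => Metric.closedBall (0 : 𝕜) (q x)) :=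
    isCompact_univ_pi fun x => isCompact_closedBall _ _
  refine h.of_isClosed_subset ?_ fun φ hφ x _ => by simpa using hφ.2.2 x
  simp only [SeminormPolar, Set.ofPred_and, Set.ofPred_forall]
  refine IsClosed.inter ?_ (IsClosed.inter ?_ ?_)
  · exact isClosed_iInter fun x => isClosed_iInter fun y =>
      isClosed_eq (by fun_prop) (by fun_prop)
  · exact isClosed_iInter fun c => isClosed_iInter fun x =>
      isClosed_eq (by fun_prop) (by fun_prop)
  · exact isClosed_iInter fun x => isClosed_le (continuous_apply _).norm continuous_const

instance (q : Seminorm 𝕜 E) : CompactSpace (SeminormPolar q) :=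
  isCompact_iff_compactSpace.1 (isCompact_seminormPolar q)

variable [TopologicalSpace E] {A : Type*} {p : SeminormFamily 𝕜 E A} (hp : WithSeminorms p)

theorem WithSeminorms.continuous_of_norm_le (hp : WithSeminorms p) (α : A) (e : E →ₗ[𝕜] 𝕜)
    (h : ∀ x, ‖e x‖ ≤ p α x) : Continuous e :=
  hp.continuous_normedSpace_rng 𝕜 e ⟨{α}, 1, fun x => by simpa using h x⟩

/-- The elements of the polar are continuous linear functionals. -/
def SeminormPolar.toCLM (hp : WithSeminorms p) {α : A} (φ : SeminormPolar (p α)) : E →L[𝕜] 𝕜 :=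
  let e : E →ₗ[𝕜] 𝕜 := { toFun := φ.1, map_add' := φ.2.1, map_smul' := φ.2.2.1 }
  ⟨e, WithSeminorms.continuous_of_norm_le hp α e φ.2.2.2⟩

theorem SeminormPolar.norm_toCLM_le {α : A} (φ : SeminormPolar (p α)) (x : E) :
    ‖SeminormPolar.toCLM hp φ x‖ ≤ p α x := φ.2.2.2 x

/-- An element of the polar. -/
def SeminormPolar.ofCLM {α : A} (e : E →L[𝕜] 𝕜) (h : ∀ x, ‖e x‖ ≤ p α x) : SeminormPolar (p α) :=
  ⟨e, map_add e, map_smul e, h⟩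

theorem exists_polar_eq (α : A) (z : E) :
    ∃ φ : SeminormPolar (p α), ‖SeminormPolar.toCLM hp φ z‖ = p α z := by
  obtain ⟨e, he, hz⟩ := exists_seminorm_dual (p α) z
  exact ⟨⟨e, map_add e, map_smul e, he⟩, hz⟩

theorem eq_of_forall_clm [T2Space E] (hp : WithSeminorms p) {z w : E}
    (h : ∀ e : E →L[𝕜] 𝕜, e z = e w) : z = w := by
  by_contra hne
  obtain ⟨α, hα⟩ := hp.separating_of_T1 (z - w) (sub_ne_zero.2 hne)
  obtain ⟨φ, hφ⟩ := exists_polar_eq hp α (z - w)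
  rw [map_sub, h, sub_self, norm_zero] at hφ
  exact hα hφ.symm

variable {X : Type*} [TopologicalSpace X]

/-- The composition of functionals with a continuous function, as a linear map. -/
def compLinear (g : C(X, E)) : (E →L[𝕜] 𝕜) →ₗ[𝕜] C(X, 𝕜) where
  toFun e := (e : C(E, 𝕜)).comp g
  map_add' _ _ := rfl
  map_smul' _ _ := rfl

@[simp] theorem compLinear_apply (g : C(X, E)) (e : E →L[𝕜] 𝕜) (x : X) :
    compLinear g e x = e (g x) := rfl

variable [IsTopologicalAddGroup E] [CompactSpace X]

/-- The functions `φ ∘ g`, with `φ` in a polar, are equicontinuous on the compact space `X`, so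
pointwise convergence is uniform. Hence the polar has compact image in `C(X, 𝕜)`. -/
theorem continuous_compLinear_toCLM (g : C(X, E)) (α : A) :
    Continuous fun φ : SeminormPolar (p α) => compLinear g (SeminormPolar.toCLM hp φ) := by
  have heq : Equicontinuous fun (φ : SeminormPolar (p α)) (x : X) => φ.1 (g x) := by
    intro x
    rw [Metric.equicontinuousAt_iff_right]
    intro ε hε
    have hc : Continuous fun y => p α (g x - g y) :=
      (hp.continuous_seminorm α).comp (continuous_const.sub g.continuous)
    have hlt : ∀ᶠ y in 𝓝 x, p α (g x - g y) < ε :=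
      hc.continuousAt.eventually_lt continuousAt_const (by simpa using hε)
    filter_upwards [hlt] with y hy φ
    rw [dist_eq_norm]
    refine lt_of_le_of_lt ?_ hy
    have := SeminormPolar.norm_toCLM_le hp φ (g x - g y)
    rwa [map_sub] at this
  rw [continuous_iff_continuousAt]
  intro φ
  refine ContinuousMap.tendsto_iff_tendstoUniformly.2 ?_
  have h := (heq.tendsto_uniformFun_iff_pi (𝓝 φ) (fun x => φ.1 (g x))).2 (by
    rw [tendsto_pi_nhds]
    intro x
    exact ((continuous_apply (g x)).comp continuous_subtype_val).tendsto φ)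
  exact UniformFun.tendsto_iff_tendstoUniformly.1 h

end Polar

/-! ### Representing functionals by points of a sequentially complete space -/

section SequentiallyComplete

variable {𝕜 : Type*} [RCLike 𝕜] {E : Type*} [AddCommGroup E] [Module 𝕜 E] [UniformSpace E]
  [IsUniformAddGroup E] [ContinuousSMul 𝕜 E]

theorem isSeqComplete_of_completeSpace [CompleteSpace E] : IsSeqComplete E :=
  fun _ hu => cauchySeq_tendsto_of_complete hu

/-- A Cauchy sequence is bounded, so it lies in a compact, hence complete, set. -/
theorem IsSemiMontel.isSeqComplete (h : IsSemiMontel 𝕜 E) : IsSeqComplete E := by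
  intro u hu
  have hc := (h _ (hu.totallyBounded_range.isVonNBounded 𝕜)).isComplete
  obtain ⟨x, -, hx⟩ := cauchySeq_tendsto_of_isComplete hc
    (fun n => subset_closure (Set.mem_range_self n)) hu
  exact ⟨x, hx⟩

variable {A : Type*} {p : SeminormFamily 𝕜 E A}

theorem cauchySeq_of_seminorms (hp : WithSeminorms p) {u : ℕ → E}
    (h : ∀ α, ∀ ε > 0, ∃ N, ∀ m ≥ N, ∀ n ≥ N, p α (u n - u m) < ε) : CauchySeq u := by
  rw [cauchySeq_iff_tendsto, uniformity_eq_comap_nhds_zero, tendsto_comap_iff, hp.tendsto_nhds]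
  intro α ε hε
  obtain ⟨N, hN⟩ := h α ε hε
  filter_upwards [eventually_ge_atTop (N, N)] with q hq
  simpa using hN q.1 hq.1 q.2 hq.2

variable {X : Type*} [TopologicalSpace X] [CompactSpace X] [LocallyCompactSpace X]
  [SecondCountableTopology X]

/-- In a sequentially complete space, a functional on the dual that is bounded by the supremum over
the range of a continuous function on a second countable compact space is represented by a point. -/
theorem exists_represent [T2Space E] (hp : WithSeminorms p) (hE : IsSeqComplete E) (g : C(X, E))
    (φ : (E →L[𝕜] 𝕜) →ₗ[𝕜] 𝕜) {C : ℝ} (hC : 0 ≤ C)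
    (h : ∀ e, ‖φ e‖ ≤ C * ‖compLinear g e‖) : ∃ z : E, ∀ e, φ e = e z := by
  -- This is `C` times the closed absolutely convex hull of the range of `g`, described by its
  -- polar. It contains every `C • g x`, so `φ e` is dominated by the supremum of `‖e‖` over `L`.
  set L : Set E := {z | ∀ e : E →L[𝕜] 𝕜, ‖e z‖ ≤ C * ‖compLinear g e‖} with hL
  have hLc : IsAbsConvex 𝕜 L := by
    intro x hx y hy a b hab e
    have h0 : 0 ≤ C * ‖compLinear g e‖ := by positivity
    rw [map_add, map_smul, map_smul]
    calc ‖a • e x + b • e y‖ ≤ ‖a‖ * ‖e x‖ + ‖b‖ * ‖e y‖ := by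
          refine (norm_add_le _ _).trans ?_
          rw [norm_smul, norm_smul]
      _ ≤ ‖a‖ * (C * ‖compLinear g e‖) + ‖b‖ * (C * ‖compLinear g e‖) := by
          gcongr
          exacts [hx e, hy e]
      _ ≤ 1 * (C * ‖compLinear g e‖) := by
          rw [← add_mul]
          gcongr
      _ = _ := one_mul _
  have hL0 : (0 : E) ∈ L := fun e => by
    rw [map_zero, norm_zero]
    positivity
  have hsup : ∀ (e : E →L[𝕜] 𝕜) (R : ℝ), (∀ a ∈ L, ‖e a‖ ≤ R) → ‖φ e‖ ≤ R := by
    intro e R hR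
    refine (h e).trans ?_
    have hR0 : 0 ≤ R := by simpa using hR 0 hL0
    rcases hC.eq_or_lt with rfl | hC0
    · simpa using hR0
    rw [mul_comm, ← le_div_iff₀ hC0, ContinuousMap.norm_le _ (by positivity)]
    intro x
    rw [le_div_iff₀ hC0, mul_comm]
    have hmem : (C : 𝕜) • g x ∈ L := fun e' => by
      rw [map_smul, norm_smul, RCLike.norm_ofReal, abs_of_nonneg hC]
      gcongr
      exact (compLinear g e').norm_coe_le_norm x
    have := hR _ hmem
    rwa [map_smul, norm_smul, RCLike.norm_ofReal, abs_of_nonneg hC] at this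
  -- Second countability of `X` makes `C(X, 𝕜)` second countable, so countably many functionals `e
  -- i` suffice to test on `L`.
  obtain ⟨s, hs⟩ := TopologicalSpace.exists_dense_seq (Set.range (compLinear (𝕜 := 𝕜) g))
  choose e he using fun i => (s i).2
  have hdense : ∀ (e' : E →L[𝕜] 𝕜) (ε : ℝ), 0 < ε → ∃ i, ‖compLinear g (e' - e i)‖ < ε := by
    intro e' ε hε
    obtain ⟨i, hi⟩ := hs.exists_dist_lt ⟨_, e', rfl⟩ hε
    refine ⟨i, ?_⟩
    rw [map_sub, he, ← dist_eq_norm]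
    exact hi
  have happrox : ∀ n : ℕ, ∃ z ∈ L, ∀ i ≤ n, ‖e i z - φ (e i)‖ < 1 / ((n : ℝ) + 1) := by
    intro n
    have key := mem_closure_of_forall_norm_le hLc (fun i : Fin (n + 1) => (e i : E →ₗ[𝕜] 𝕜))
      (fun i => φ (e i)) (fun c R hR => by
        have := hsup (∑ i, c i • e i) R (fun a ha => by simpa using hR a ha)
        simpa using this)
    obtain ⟨_, ⟨z, hz, rfl⟩, hz'⟩ := Metric.mem_closure_iff.1 key (1 / ((n : ℝ) + 1)) (by positivity)
    refine ⟨z, hz, fun i hi => ?_⟩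
    have h1 := (dist_pi_lt_iff (by positivity)).1 hz' ⟨i, Nat.lt_succ_of_le hi⟩
    rw [dist_comm, dist_eq_norm] at h1
    exact h1
  choose z hzL hz using happrox
  have hlim : ∀ e' : E →L[𝕜] 𝕜, Tendsto (fun n => e' (z n)) atTop (𝓝 (φ e')) := by
    intro e'
    rw [Metric.tendsto_atTop]
    intro ε hε
    -- Replacing `e'` by a nearby `e i` costs little, uniformly on `L` and for `φ`. The constant `C
    -- + 1` avoids division by zero.
    obtain ⟨i, hi⟩ := hdense e' (ε / (4 * (C + 1))) (by positivity)
    obtain ⟨N, hN⟩ := exists_nat_one_div_lt (half_pos hε)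
    refine ⟨max N i, fun n hn => ?_⟩
    rw [dist_eq_norm]
    have e1 : e' (z n) - φ e' = (e' - e i) (z n) + (e i (z n) - φ (e i)) - φ (e' - e i) := by
      rw [map_sub, sub_apply]
      ring
    have hsmall : C * ‖compLinear g (e' - e i)‖ ≤ ε / 4 := by
      calc C * ‖compLinear g (e' - e i)‖ ≤ (C + 1) * (ε / (4 * (C + 1))) := by
            gcongr
            linarith
        _ = ε / 4 := by field_simp
    have h1 : ‖(e' - e i) (z n)‖ ≤ ε / 4 := (hzL n _).trans hsmall
    have h2 : ‖φ (e' - e i)‖ ≤ ε / 4 := (h _).trans hsmall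
    have h3 : ‖e i (z n) - φ (e i)‖ < ε / 2 := by
      refine (hz n i ((le_max_right _ _).trans hn)).trans (lt_of_le_of_lt ?_ hN)
      have : (N : ℝ) ≤ n := by exact_mod_cast (le_max_left _ _).trans hn
      gcongr
    rw [e1]
    calc _ ≤ ‖(e' - e i) (z n)‖ + ‖e i (z n) - φ (e i)‖ + ‖φ (e' - e i)‖ :=
          (norm_sub_le _ _).trans (by gcongr; exact norm_add_le _ _)
      _ < ε := by linarith
  have hcauchy : CauchySeq z := by
    refine cauchySeq_of_seminorms hp fun α ε hε => ?_
    -- Weak convergence becomes convergence in `p α`: the polar has compact image in `C(X, 𝕜)`, so a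
    -- finite net of functionals handles all of it, and some element of the polar attains `p α (z n
    -- - z m)`.
    have hcomp := isCompact_range (continuous_compLinear_toCLM hp g α)
    obtain ⟨t, hts, htf, ht⟩ := finite_cover_balls_of_compact hcomp
      (e := ε / (8 * (C + 1))) (by positivity)
    have hev : ∀ᶠ N in atTop, ∀ f ∈ t, ∃ ψ : SeminormPolar (p α),
        compLinear g (SeminormPolar.toCLM hp ψ) = f ∧
        ∀ m ≥ N, ∀ n ≥ N, ‖SeminormPolar.toCLM hp ψ (z n - z m)‖ < ε / 2 := by
      rw [Filter.eventually_all_finite htf]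
      intro f hf
      obtain ⟨ψ, rfl⟩ := hts hf
      obtain ⟨N, hN⟩ := Metric.cauchySeq_iff.1 (hlim (SeminormPolar.toCLM hp ψ)).cauchySeq
        (ε / 2) (half_pos hε)
      filter_upwards [eventually_ge_atTop N] with N' hN'
      refine ⟨ψ, rfl, fun m hm n hn => ?_⟩
      have h1 := hN n (hN'.trans hn) m (hN'.trans hm)
      rwa [dist_eq_norm, ← map_sub] at h1
    obtain ⟨N, hN⟩ := hev.exists
    refine ⟨N, fun m hm n hn => ?_⟩
    obtain ⟨ψ, hψ⟩ := exists_polar_eq hp α (z n - z m)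
    rw [← hψ]
    obtain ⟨f, hft, hf⟩ := Set.mem_iUnion₂.1 (ht ⟨ψ, rfl⟩)
    obtain ⟨ψ₀, rfl, h0⟩ := hN f hft
    have h1 := h0 m hm n hn
    rw [Metric.mem_ball, dist_eq_norm, ← map_sub] at hf
    have h2 : ∀ k, ‖(SeminormPolar.toCLM hp ψ - SeminormPolar.toCLM hp ψ₀) (z k)‖ ≤ ε / 8 := by
      intro k
      refine (hzL k _).trans ?_
      calc C * ‖compLinear g (SeminormPolar.toCLM hp ψ - SeminormPolar.toCLM hp ψ₀)‖
          ≤ (C + 1) * (ε / (8 * (C + 1))) := by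
            gcongr
            linarith
        _ = ε / 8 := by field_simp
    have e1 : SeminormPolar.toCLM hp ψ (z n - z m) =
        (SeminormPolar.toCLM hp ψ - SeminormPolar.toCLM hp ψ₀) (z n) -
        (SeminormPolar.toCLM hp ψ - SeminormPolar.toCLM hp ψ₀) (z m) +
        SeminormPolar.toCLM hp ψ₀ (z n - z m) := by
      simp only [sub_apply, map_sub]
      ring
    rw [e1]
    calc _ ≤ _ := (norm_add_le _ _).trans (add_le_add_left (norm_sub_le _ _) _)
      _ < ε := by linarith [h2 n, h2 m]
  obtain ⟨z₀, hz₀⟩ := hE z hcauchy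
  exact ⟨z₀, fun e' => tendsto_nhds_unique (hlim e') ((e'.continuous.tendsto z₀).comp hz₀)⟩

end SequentiallyComplete

/-! ### Continuous functions on `X × ℕ∞` from null sequences -/

section Gluing

variable {𝕜 : Type*} [RCLike 𝕜] {E : Type*} [AddCommGroup E] [Module 𝕜 E] [TopologicalSpace E]
  {A : Type*} {p : SeminormFamily 𝕜 E A} {X : Type*} [TopologicalSpace X]

/-- A sequence of continuous functions that tends to zero uniformly is a continuous function of the
point and the index in `ℕ∞`. -/
theorem exists_continuous_glue (hp : WithSeminorms p) (t : ℕ → C(X, E))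
    (ht : ∀ α, ∀ ε > 0, ∀ᶠ n in atTop, ∀ x, p α (t n x) < ε) :
    ∃ G : C(X × ℕ∞, E), (∀ x (n : ℕ), G (x, n) = t n x) ∧ ∀ x, G (x, ⊤) = 0 := by
  classical
  let G : X × ℕ∞ → E := fun q => if q.2 = ⊤ then 0 else t q.2.toNat q.1
  have hG : ∀ x (n : ℕ), G (x, n) = t n x := fun x n => by simp [G]
  have hG' : ∀ x, G (x, ⊤) = 0 := fun x => by simp [G]
  refine ⟨⟨G, continuous_iff_continuousAt.2 ?_⟩, hG, hG'⟩
  rintro ⟨x, m⟩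
  induction m using ENat.recTopCoe with
  | coe n =>
    -- Finite indices are isolated points of `ℕ∞`; only `⊤` uses the uniform convergence.
    rw [ContinuousAt, nhds_prod_eq, ENat.nhds_natCast, hG, prod_pure, tendsto_map'_iff]
    exact ((t n).continuous.tendsto x).congr fun y => (hG y n).symm
  | top =>
    rw [ContinuousAt, hG', hp.tendsto_nhds]
    intro α ε hε
    obtain ⟨N, hN⟩ := eventually_atTop.1 (ht α ε hε)
    have hev : ∀ᶠ q : X × ℕ∞ in 𝓝 (x, ⊤), (N : ℕ∞) < q.2 :=
      continuous_snd.continuousAt.eventually_mem (Ioi_mem_nhds (ENat.natCast_lt_top N))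
    filter_upwards [hev] with ⟨y, m⟩ hm
    induction m using ENat.recTopCoe with
    | coe n =>
      rw [hG, sub_zero]
      replace hm : (N : ℕ∞) < n := hm
      exact hN n (by exact_mod_cast hm.le) y
    | top => simpa [hG'] using hε

end Gluing

/-! ### Weighted derivatives on a compact set and the functions `e ∘ f` -/

section Range

variable {𝕜 : Type*} [RCLike 𝕜] {E : Type*} [AddCommGroup E] [Module 𝕜 E] [TopologicalSpace E]
  [T2Space E] [IsTopologicalAddGroup E] [ContinuousSMul 𝕜 E]
  {d : ℕ} {Ω : Opens (EuclideanSpace ℝ (Fin d))} {J : Type*} {ν : J → ℕ → ℝ≥0}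
  {A : Type*} {p : SeminormFamily 𝕜 E A}

theorem IsSmooth.continuous_iterPartial {f : Ω → E} (hf : IsSmooth 𝕜 f) (β : Fin d → ℕ) :
    Continuous (iterPartial 𝕜 β f) := by
  rw [iterPartial_eq_listPartial]
  exact (hf.listPartial _).continuous

theorem weightedVal_le_seminorm (f : WeightedSpace 𝕜 Ω ν p) (K : Compacts Ω) (j : J) (α : A)
    {x : Ω} (hx : x ∈ K) (β : Fin d → ℕ) :
    p α (iterPartial 𝕜 β f.1 x) * ν j (∑ n, β n) ≤ WeightedSpace.seminorm 𝕜 Ω ν p K j α f :=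
  le_ciSup (f.2.2 K j α) (⟨x, hx⟩, β)

theorem seminorm_le_of_forall (f : WeightedSpace 𝕜 Ω ν p) (K : Compacts Ω) (j : J) (α : A) {R : ℝ}
    (hR : 0 ≤ R) (h : ∀ x ∈ K, ∀ β : Fin d → ℕ,
      p α (iterPartial 𝕜 β f.1 x) * ν j (∑ n, β n) ≤ R) :
    WeightedSpace.seminorm 𝕜 Ω ν p K j α f ≤ R :=
  Real.iSup_le (fun z => h z.1.1 z.1.2 z.2) hR

theorem finite_multiindex_sum_lt (N : ℕ) : {β : Fin d → ℕ | ∑ n, β n < N}.Finite := by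
  refine (Set.finite_Iic (fun _ : Fin d => N)).subset fun β hβ n => ?_
  exact (Finset.single_le_sum (fun i _ => Nat.zero_le (β i)) (Finset.mem_univ n)).trans hβ.le

/-- The weighted derivatives of a function on a compact set form, together with zero, the range of
a continuous function on a second countable compact space. -/
theorem exists_continuous_range (hp : WithSeminorms p)
    (hdecay : ∀ j, ∃ j', ∃ c : ℕ → ℝ≥0, Tendsto c atTop (𝓝 0) ∧ ∀ n, ν j n ≤ c n * ν j' n)
    (f : WeightedSpace 𝕜 Ω ν p) (K : Compacts Ω) (j : J) :
    ∃ G : C(K × ℕ∞, E), ∀ (x : K) (β : Fin d → ℕ), ∃ q,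
      G q = ((ν j (∑ n, β n) : ℝ) : 𝕜) • iterPartial 𝕜 β f.1 x.1 := by
  obtain ⟨j', c, hc, hcν⟩ := hdecay j
  have := Encodable.ofCountable (Fin d → ℕ)
  let D : (Fin d → ℕ) → C(K, E) := fun β =>
    ⟨fun x => ((ν j (∑ n, β n) : ℝ) : 𝕜) • iterPartial 𝕜 β f.1 x.1,
      ((f.2.1.continuous_iterPartial β).comp continuous_subtype_val).const_smul _⟩
  -- The multi-indices are enumerated by their codes. With `decode₂` a number counts only if it is
  -- the code of its multi-index; all others give the zero function.
  let t : ℕ → C(K, E) := fun n => (Encodable.decode₂ (Fin d → ℕ) n).elim 0 D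
  have ht : ∀ α, ∀ ε > 0, ∀ᶠ n in atTop, ∀ x, p α (t n x) < ε := by
    intro α ε hε
    set B := WeightedSpace.seminorm 𝕜 Ω ν p K j' α f with hB
    have hlim : Tendsto (fun n => (c n : ℝ) * B) atTop (𝓝 0) := by
      have h1 : Tendsto (fun n => (c n : ℝ)) atTop (𝓝 0) := by
        simpa using NNReal.tendsto_coe.2 hc
      simpa using h1.mul_const B
    obtain ⟨N, hN⟩ := eventually_atTop.1 (hlim.eventually_lt_const hε)
    -- Only finitely many multi-indices have order below `N`. Beyond their codes, the bound `c n * B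
    -- < ε` applies.
    have hfin := (finite_multiindex_sum_lt (d := d) N).image Encodable.encode
    have hev : ∀ᶠ n in atTop, n ∉ Encodable.encode '' {β : Fin d → ℕ | ∑ n, β n < N} := by
      have := hfin.compl_mem_cofinite
      rwa [Nat.cofinite_eq_atTop] at this
    filter_upwards [hev] with n hn x
    rcases hd : Encodable.decode₂ (Fin d → ℕ) n with _ | β
    · simpa [t, hd] using hε
    · have hβ : ¬ ∑ n, β n < N := fun hlt => hn ⟨β, hlt, Encodable.mem_decode₂.1 hd⟩
      have e1 : t n x = ((ν j (∑ n, β n) : ℝ) : 𝕜) • iterPartial 𝕜 β f.1 x.1 := by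
        simp [t, hd, D]
      rw [e1, map_smul_eq_mul, RCLike.norm_ofReal, abs_of_nonneg (NNReal.coe_nonneg _)]
      refine lt_of_le_of_lt ?_ (hN _ (not_lt.1 hβ))
      have h1 := weightedVal_le_seminorm f K j' α x.2 β
      have h2 : (ν j (∑ n, β n) : ℝ) ≤ c (∑ n, β n) * ν j' (∑ n, β n) := by
        exact_mod_cast hcν _
      calc _ ≤ (c (∑ n, β n) * ν j' (∑ n, β n) : ℝ) * p α (iterPartial 𝕜 β f.1 x.1) := by
            gcongr
        _ = c (∑ n, β n) * (p α (iterPartial 𝕜 β f.1 x.1) * ν j' (∑ n, β n)) := by ring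
        _ ≤ _ := by gcongr
  obtain ⟨G, hG, -⟩ := exists_continuous_glue hp t ht
  refine ⟨G, fun x β => ⟨(x, (Encodable.encode β : ℕ)), ?_⟩⟩
  rw [hG]
  simp [t, D]

/-- The weighted derivatives of `e ∘ f` on `K` are values of `e ∘ G`, so a seminorm of `F` is
controlled by a supremum norm. -/
theorem norm_comp_iterPartial_mul_le {f : Ω → E} (hf : IsSmooth 𝕜 f) {K : Compacts Ω} {j : J}
    {G : C(K × ℕ∞, E)} (hG : ∀ (x : K) (β : Fin d → ℕ), ∃ q,
      G q = ((ν j (∑ n, β n) : ℝ) : 𝕜) • iterPartial 𝕜 β f x.1) (e : E →L[𝕜] 𝕜) {x : Ω}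
    (hx : x ∈ K) (β : Fin d → ℕ) :
    ‖iterPartial 𝕜 β (e ∘ f) x‖ * ν j (∑ n, β n) ≤ ‖compLinear G e‖ := by
  obtain ⟨q, hq⟩ := hG ⟨x, hx⟩ β
  refine le_trans (le_of_eq ?_) ((compLinear G e).norm_coe_le_norm q)
  rw [compLinear_apply, hq, map_smul, norm_smul, RCLike.norm_ofReal,
    abs_of_nonneg (NNReal.coe_nonneg _), iterPartial_comp e hf, mul_comm]
  rfl

variable (hp : WithSeminorms p)
  (hdecay : ∀ j, ∃ j', ∃ c : ℕ → ℝ≥0, Tendsto c atTop (𝓝 0) ∧ ∀ n, ν j n ≤ c n * ν j' n)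

/-- The scalar functions `e ∘ f`. -/
def scalarComp (f : WeightedSpace 𝕜 Ω ν p) :
    (E →L[𝕜] 𝕜) →ₗ[𝕜] WeightedSpace 𝕜 Ω ν (absFamily 𝕜) where
  toFun e := ⟨e ∘ f.1, f.2.1.clm_comp e, fun K j _ => by
    obtain ⟨G, hG⟩ := exists_continuous_range hp hdecay f K j
    refine ⟨‖compLinear G e‖, ?_⟩
    rintro _ ⟨z, rfl⟩
    exact norm_comp_iterPartial_mul_le f.2.1 hG e z.1.2 z.2⟩
  map_add' _ _ := rfl
  map_smul' _ _ := rfl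

theorem seminorm_scalarComp_le (f : WeightedSpace 𝕜 Ω ν p) {K : Compacts Ω} {j : J}
    {G : C(K × ℕ∞, E)} (hG : ∀ (x : K) (β : Fin d → ℕ), ∃ q,
      G q = ((ν j (∑ n, β n) : ℝ) : 𝕜) • iterPartial 𝕜 β f.1 x.1) (e : E →L[𝕜] 𝕜) :
    WeightedSpace.seminorm 𝕜 Ω ν (absFamily 𝕜) K j () (scalarComp hp hdecay f e) ≤
      ‖compLinear G e‖ :=
  seminorm_le_of_forall _ K j () (norm_nonneg _)
    fun _ hx β => norm_comp_iterPartial_mul_le f.2.1 hG e hx β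

/-- The scalar functions `e ∘ f` for `e` in a polar. -/
def polarRange (f : WeightedSpace 𝕜 Ω ν p) (α : A) : Set (WeightedSpace 𝕜 Ω ν (absFamily 𝕜)) :=
  Set.range fun φ : SeminormPolar (p α) => scalarComp hp hdecay f (SeminormPolar.toCLM hp φ)

theorem isAbsConvex_polarRange (f : WeightedSpace 𝕜 Ω ν p) (α : A) :
    IsAbsConvex 𝕜 (polarRange hp hdecay f α) := by
  rintro _ ⟨φ, rfl⟩ _ ⟨ψ, rfl⟩ a b hab
  set e := a • SeminormPolar.toCLM hp φ + b • SeminormPolar.toCLM hp ψ with he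
  refine ⟨SeminormPolar.ofCLM e fun x => ?_, ?_⟩
  · calc ‖a * SeminormPolar.toCLM hp φ x + b * SeminormPolar.toCLM hp ψ x‖
        ≤ ‖a‖ * ‖SeminormPolar.toCLM hp φ x‖ + ‖b‖ * ‖SeminormPolar.toCLM hp ψ x‖ := by
          refine (norm_add_le _ _).trans ?_
          rw [norm_mul, norm_mul]
      _ ≤ ‖a‖ * p α x + ‖b‖ * p α x := by
          gcongr <;> exact SeminormPolar.norm_toCLM_le hp _ x
      _ ≤ 1 * p α x := by
          rw [← add_mul]
          gcongr
      _ = p α x := one_mul _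
  · change scalarComp hp hdecay f e = _
    rw [he, map_add, map_smul, map_smul]

/-- The polar is compact, and each seminorm of `F` is dominated by a norm in some `C(K × ℕ∞, 𝕜)`,
into which the polar maps continuously. This compact set tests the continuity of the preimage of `f`
under `S`. -/
theorem isCompact_polarRange (f : WeightedSpace 𝕜 Ω ν p) (α : A) :
    IsCompact (polarRange hp hdecay f α) := by
  refine isCompact_range (continuous_iff_continuousAt.2 fun φ => ?_)
  refine ((WeightedSpace.withSeminorms 𝕜 Ω ν (absFamily 𝕜)).tendsto_nhds _ _).2 ?_
  rintro ⟨K, j, -⟩ ε hε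
  obtain ⟨G, hG⟩ := exists_continuous_range hp hdecay f K j
  have : CompactSpace K := isCompact_iff_compactSpace.1 K.isCompact
  have hc := (continuous_compLinear_toCLM hp G α).tendsto φ
  filter_upwards [Metric.tendsto_nhds.1 hc ε hε] with ψ hψ
  rw [dist_eq_norm, ← map_sub] at hψ
  rw [← map_sub]
  exact (seminorm_scalarComp_le hp hdecay f hG _).trans_lt hψ

end Range

/-! ### Domination by a single seminorm -/

section Directed

variable {𝕜 : Type*} [RCLike 𝕜] {d : ℕ} {Ω : Opens (EuclideanSpace ℝ (Fin d))}
  {J : Type*} [Nonempty J] {ν : J → ℕ → ℝ≥0}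

theorem seminorm_mono {K K' : Compacts Ω} {j j' : J} (hK : K ≤ K') (hj : ∀ n, ν j n ≤ ν j' n) :
    WeightedSpace.seminorm 𝕜 Ω ν (absFamily 𝕜) K j () ≤
      WeightedSpace.seminorm 𝕜 Ω ν (absFamily 𝕜) K' j' () := by
  intro f
  refine seminorm_le_of_forall f K j () (apply_nonneg _ _) fun x hx β => ?_
  refine le_trans ?_ (weightedVal_le_seminorm f K' j' () (hK hx) β)
  gcongr
  exact hj _

theorem exists_bound_seminorm
    (hdir : ∀ j₁ j₂, ∃ j, ∀ n, ν j₁ n ≤ ν j n ∧ ν j₂ n ≤ ν j n)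
    (q : Seminorm 𝕜 (WeightedSpace 𝕜 Ω ν (absFamily 𝕜))) (hq : Continuous q) :
    ∃ (K : Compacts Ω) (j : J) (C : ℝ), 0 ≤ C ∧
      ∀ f, q f ≤ C * WeightedSpace.seminorm 𝕜 Ω ν (absFamily 𝕜) K j () f := by
  obtain ⟨s, C, -, hs⟩ := Seminorm.bound_of_continuous
    (WeightedSpace.withSeminorms 𝕜 Ω ν (absFamily 𝕜)) q hq
  have key : ∃ (K : Compacts Ω) (j : J),
      s.sup (WeightedSpace.seminormFamily 𝕜 Ω ν (absFamily 𝕜)) ≤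
        WeightedSpace.seminorm 𝕜 Ω ν (absFamily 𝕜) K j () := by
    clear hs
    classical
    induction s using Finset.induction_on with
    | empty => exact ⟨⊥, Classical.arbitrary J, bot_le⟩
    | insert i s _ ih =>
      obtain ⟨K, j, h⟩ := ih
      obtain ⟨K', j', u⟩ := i
      obtain ⟨j'', hj''⟩ := hdir j j'
      refine ⟨K ⊔ K', j'', ?_⟩
      rw [Finset.sup_insert]
      exact sup_le (seminorm_mono le_sup_right fun n => (hj'' n).2)
        (h.trans (seminorm_mono le_sup_left fun n => (hj'' n).1))
  obtain ⟨K, j, h⟩ := key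
  exact ⟨K, j, C, C.2, fun f => (hs f).trans (mul_le_mul_of_nonneg_left (h f) C.2)⟩

end Directed

/-! ### The map `S` as a topological isomorphism -/

section Linearisation

variable {𝕜 : Type*} [RCLike 𝕜] {E : Type*} [AddCommGroup E] [Module 𝕜 E] [UniformSpace E]
  [IsUniformAddGroup E] [ContinuousSMul 𝕜 E] [T2Space E]
  {d : ℕ} {Ω : Opens (EuclideanSpace ℝ (Fin d))} {J : Type*} [Nonempty J] {ν : J → ℕ → ℝ≥0}
  {A : Type*} {p : SeminormFamily 𝕜 E A} (hpos : ∀ j n, 0 < ν j n)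

theorem norm_derivEval_mul_le (f : WeightedSpace 𝕜 Ω ν (absFamily 𝕜)) (K : Compacts Ω) (j : J)
    {x : Ω} (hx : x ∈ K) (β : Fin d → ℕ) :
    ‖(((ν j (∑ n, β n) : ℝ) : 𝕜) • derivEval hpos (multiList β) x) f‖ ≤
      WeightedSpace.seminorm 𝕜 Ω ν (absFamily 𝕜) K j () f := by
  refine le_trans (le_of_eq ?_) (norm_iterPartial_mul_le f K j hx β)
  change ‖((ν j (∑ n, β n) : ℝ) : 𝕜) • derivEval hpos (multiList β) x f‖ = _
  rw [norm_smul, RCLike.norm_ofReal, abs_of_nonneg (NNReal.coe_nonneg _), derivEval_apply,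
    iterPartial_eq_listPartial, mul_comm]

variable (T : DualKappa 𝕜 (WeightedSpace 𝕜 Ω ν (absFamily 𝕜)) →L[𝕜] E)

theorem iterPartial_comp_derivEval (β : Fin d → ℕ) (x : Ω) :
    iterPartial 𝕜 β (T ∘ derivEval hpos []) x = T (derivEval hpos (multiList β) x) := by
  rw [iterPartial_comp T (isSmooth_derivEval hpos []), iterPartial_derivEval_nil]
  rfl

theorem weightedVal_comp_derivEval (K : Compacts Ω) (j : J) (α : A)
    (z : {x : Ω // x ∈ K} × (Fin d → ℕ)) :
    weightedVal 𝕜 Ω ν p (T ∘ derivEval hpos []) K j α z =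
      p α (T (((ν j (∑ n, z.2 n) : ℝ) : 𝕜) • derivEval hpos (multiList z.2) z.1.1)) := by
  rw [weightedVal, iterPartial_comp_derivEval, map_smul, map_smul_eq_mul, RCLike.norm_ofReal,
    abs_of_nonneg (NNReal.coe_nonneg _), mul_comm]

/-- Continuity dominates `p α ∘ T` by the supremum over a compact `Q ⊆ F`. The weighted derivative
evaluations are bounded on `Q`, since a seminorm of `F` is. -/
theorem bddAbove_comp_derivEval (hp : WithSeminorms p) (K : Compacts Ω) (j : J) (α : A) :
    BddAbove (Set.range (weightedVal 𝕜 Ω ν p (T ∘ derivEval hpos []) K j α)) := by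
  obtain ⟨Q, -, hQ, -, h⟩ := exists_bound_of_continuous_seminorm ((p α).comp T.toLinearMap)
    ((hp.continuous_seminorm α).comp T.continuous)
  obtain ⟨B, hB⟩ := hQ.bddAbove_image
    ((WeightedSpace.withSeminorms 𝕜 Ω ν (absFamily 𝕜)).continuous_seminorm (K, j, ())).continuousOn
  refine ⟨B, ?_⟩
  rintro _ ⟨z, rfl⟩
  rw [weightedVal_comp_derivEval]
  exact h _ B fun f hf =>
    (norm_derivEval_mul_le hpos f K j z.1.2 z.2).trans (hB (Set.mem_image_of_mem _ hf))

/-- The linear map `u ↦ (x ↦ u(δ_x))`. -/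
def evalDelta (hp : WithSeminorms p) :
    EpsProd 𝕜 (WeightedSpace 𝕜 Ω ν (absFamily 𝕜)) E →ₗ[𝕜] WeightedSpace 𝕜 Ω ν p where
  toFun u :=
    let T := (ContinuousLinearMap.toUniformConvergenceCLM (RingHom.id 𝕜) E _).symm u
    ⟨T ∘ derivEval hpos [], (isSmooth_derivEval hpos []).clm_comp T,
      fun K j α => bddAbove_comp_derivEval hpos T hp K j α⟩
  map_add' _ _ := rfl
  map_smul' _ _ := rfl

/-- Choose `e` in the polar of `p α` with `‖e (u y)‖ = p α (u y)`. As a functional on `F'_κ`, `e ∘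
u` is evaluation at some `f`; testing on the `δ_x` shows `f = e ∘ S u`, whose seminorm is at most
that of `S u`. -/
theorem seminorm_apply_le (hp : WithSeminorms p)
    (u : EpsProd 𝕜 (WeightedSpace 𝕜 Ω ν (absFamily 𝕜)) E) {K : Compacts Ω} {j : J} {C : ℝ}
    (hC : 0 ≤ C) {y : DualKappa 𝕜 (WeightedSpace 𝕜 Ω ν (absFamily 𝕜))}
    (hy : ∀ f, ‖y f‖ ≤ C * WeightedSpace.seminorm 𝕜 Ω ν (absFamily 𝕜) K j () f) (α : A) :
    p α (u y) ≤ C * WeightedSpace.seminorm 𝕜 Ω ν p K j α (evalDelta hpos hp u) := by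
  obtain ⟨φ, hφ⟩ := exists_polar_eq hp α (u y)
  set e := SeminormPolar.toCLM hp φ
  set T := (ContinuousLinearMap.toUniformConvergenceCLM (RingHom.id 𝕜) E _).symm u with hT
  obtain ⟨f, hf⟩ := exists_eq_eval (e.comp T)
  have h1 : e (u y) = y f := hf y
  rw [← hφ, h1]
  refine (hy f).trans (mul_le_mul_of_nonneg_left ?_ hC)
  have hfe : f.1 = e ∘ (evalDelta hpos hp u).1 :=
    funext fun x => (hf (derivEval hpos [] x)).symm
  refine seminorm_le_of_forall f K j () (apply_nonneg _ _) fun x hx β => ?_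
  rw [hfe, iterPartial_comp e (evalDelta hpos hp u).2.1]
  refine le_trans ?_ (weightedVal_le_seminorm (evalDelta hpos hp u) K j α hx β)
  gcongr
  exact SeminormPolar.norm_toCLM_le hp φ _

theorem continuous_evalDelta (hp : WithSeminorms p) :
    Continuous (evalDelta (Ω := Ω) hpos hp) := by
  refine continuous_of_tendsto_nhds_zero _
    (((WeightedSpace.withSeminorms 𝕜 Ω ν p).tendsto_nhds _ _).2 ?_)
  rintro ⟨K, j, α⟩ ε hε
  -- The seminorm of `S u` is the supremum of `p α` over `u(H)`. A supremum of strict bounds is only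
  -- bounded weakly, hence `ε / 2` below.
  set H : Set (DualKappa 𝕜 (WeightedSpace 𝕜 Ω ν (absFamily 𝕜))) :=
    {y | ∃ x ∈ K, ∃ β : Fin d → ℕ,
      y = ((ν j (∑ n, β n) : ℝ) : 𝕜) • derivEval hpos (multiList β) x} with hH
  have hHe : Equicontinuous fun (y : H) (f : WeightedSpace 𝕜 Ω ν (absFamily 𝕜)) => y.1 f := by
    refine equicontinuous_iff_exists_seminorm.2 ⟨WeightedSpace.seminorm 𝕜 Ω ν (absFamily 𝕜) K j (),
      (WeightedSpace.withSeminorms 𝕜 Ω ν (absFamily 𝕜)).continuous_seminorm (K, j, ()), ?_⟩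
    rintro _ ⟨x, hx, β, rfl⟩ f
    exact norm_derivEval_mul_le hpos f K j hx β
  have hV : {z : E | p α z < ε / 2} ∈ 𝓝 0 :=
    (isOpen_lt (hp.continuous_seminorm α) continuous_const).mem_nhds (by simpa using half_pos hε)
  have hev := UniformConvergenceCLM.eventually_nhds_zero_mapsTo (RingHom.id 𝕜)
    (𝔖 := {H : Set (DualKappa 𝕜 (WeightedSpace 𝕜 Ω ν (absFamily 𝕜))) |
      Equicontinuous (fun (y : H) (f : WeightedSpace 𝕜 Ω ν (absFamily 𝕜)) => y.1 f)}) hHe hV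
  filter_upwards [hev] with u hu
  rw [sub_zero]
  refine lt_of_le_of_lt ?_ (half_lt_self hε)
  refine Real.iSup_le (fun z => ?_) (half_pos hε).le
  refine le_trans (le_of_eq (weightedVal_comp_derivEval hpos _ K j α z)) ?_
  exact (hu ⟨z.1.1, z.1.2, z.2, rfl⟩ : _ < _).le

theorem exists_norm_apply_le (hdir : ∀ j₁ j₂, ∃ j, ∀ n, ν j₁ n ≤ ν j n ∧ ν j₂ n ≤ ν j n)
    (y : DualKappa 𝕜 (WeightedSpace 𝕜 Ω ν (absFamily 𝕜))) :
    ∃ (K : Compacts Ω) (j : J) (C : ℝ), 0 ≤ C ∧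
      ∀ f, ‖y f‖ ≤ C * WeightedSpace.seminorm 𝕜 Ω ν (absFamily 𝕜) K j () f :=
  exists_bound_seminorm hdir
    ((normSeminorm 𝕜 𝕜).comp (y : WeightedSpace 𝕜 Ω ν (absFamily 𝕜) →ₗ[𝕜] 𝕜))
    (map_continuous y).norm

theorem injective_evalDelta (hp : WithSeminorms p)
    (hdir : ∀ j₁ j₂, ∃ j, ∀ n, ν j₁ n ≤ ν j n ∧ ν j₂ n ≤ ν j n) :
    Function.Injective (evalDelta (Ω := Ω) hpos hp) := by
  refine (injective_iff_map_eq_zero _).2 fun u hu => ?_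
  refine UniformConvergenceCLM.ext _ _ fun y => ?_
  obtain ⟨K, j, C, hC, h⟩ := exists_norm_apply_le hdir y
  by_contra hne
  obtain ⟨α, hα⟩ := hp.separating_of_T1 (u y) hne
  have h1 := seminorm_apply_le hpos hp u hC h α
  rw [hu, map_zero, mul_zero] at h1
  exact hα (le_antisymm h1 (apply_nonneg _ _))

theorem exists_linearisation_apply
    (hdecay : ∀ j, ∃ j', ∃ c : ℕ → ℝ≥0, Tendsto c atTop (𝓝 0) ∧ ∀ n, ν j n ≤ c n * ν j' n)
    (hp : WithSeminorms p) (hE : IsSeqComplete E)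
    (hdir : ∀ j₁ j₂, ∃ j, ∀ n, ν j₁ n ≤ ν j n ∧ ν j₂ n ≤ ν j n)
    (f : WeightedSpace 𝕜 Ω ν p) (y : DualKappa 𝕜 (WeightedSpace 𝕜 Ω ν (absFamily 𝕜))) :
    ∃ z : E, ∀ e : E →L[𝕜] 𝕜, y (scalarComp hp hdecay f e) = e z := by
  obtain ⟨K, j, C, hC, h⟩ := exists_norm_apply_le hdir y
  obtain ⟨G, hG⟩ := exists_continuous_range hp hdecay f K j
  have : CompactSpace K := isCompact_iff_compactSpace.1 K.isCompact
  exact exists_represent hp hE G ((y : _ →ₗ[𝕜] 𝕜) ∘ₗ scalarComp hp hdecay f) hC fun e =>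
    (h _).trans (mul_le_mul_of_nonneg_left (seminorm_scalarComp_le hp hdecay f hG e) hC)

/-- The representing points are unique, as `E'` separates points, so they depend linearly on `y`.
Moreover `p α (z y)` is attained on the polar, hence at most the supremum of `‖y‖` over
`polarRange`, a test set of `F'_κ`. At `y = δ_x` the point is `f x`. -/
theorem surjective_evalDelta
    (hdecay : ∀ j, ∃ j', ∃ c : ℕ → ℝ≥0, Tendsto c atTop (𝓝 0) ∧ ∀ n, ν j n ≤ c n * ν j' n)
    (hp : WithSeminorms p) (hE : IsSeqComplete E)
    (hdir : ∀ j₁ j₂, ∃ j, ∀ n, ν j₁ n ≤ ν j n ∧ ν j₂ n ≤ ν j n) :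
    Function.Surjective (evalDelta (Ω := Ω) hpos hp) := by
  intro f
  choose z hz using exists_linearisation_apply hdecay hp hE hdir f
  let u : DualKappa 𝕜 (WeightedSpace 𝕜 Ω ν (absFamily 𝕜)) →ₗ[𝕜] E :=
    { toFun := z
      map_add' := fun y y' => eq_of_forall_clm hp fun e => by
        rw [map_add, ← hz, ← hz, ← hz]
        rfl
      map_smul' := fun c y => eq_of_forall_clm hp fun e => by
        rw [map_smul, ← hz, ← hz]
        rfl }
  have hu : Continuous u := by
    refine continuous_of_tendsto_nhds_zero u ((hp.tendsto_nhds _ _).2 fun α ε hε => ?_)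
    have hev := UniformConvergenceCLM.eventually_nhds_zero_mapsTo (RingHom.id 𝕜)
      (𝔖 := {K : Set (WeightedSpace 𝕜 Ω ν (absFamily 𝕜)) | IsAbsConvex 𝕜 K ∧ IsCompact K})
      ⟨isAbsConvex_polarRange hp hdecay f α, isCompact_polarRange hp hdecay f α⟩
      (Metric.ball_mem_nhds (0 : 𝕜) hε)
    filter_upwards [hev] with y hy
    obtain ⟨φ, hφ⟩ := exists_polar_eq hp α (u y)
    rw [sub_zero, ← hφ]
    have h1 : SeminormPolar.toCLM hp φ (u y) =
        y (scalarComp hp hdecay f (SeminormPolar.toCLM hp φ)) := (hz y _).symm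
    rw [h1, ← mem_ball_zero_iff]
    exact hy ⟨φ, rfl⟩
  refine ⟨ContinuousLinearMap.toUniformConvergenceCLM (RingHom.id 𝕜) E _ ⟨u, hu⟩,
    Subtype.ext (funext fun x => ?_)⟩
  exact eq_of_forall_clm hp fun e => (hz (derivEval hpos [] x) e).symm

/-- The linearisation of spaces of weighted smooth functions with values in a sequentially complete
space. -/
theorem isLinearisation_of_isSeqComplete (hp : WithSeminorms p) (hE : IsSeqComplete E)
    (hpos : ∀ j n, 0 < ν j n)
    (hdir : ∀ j₁ j₂, ∃ j, ∀ n, ν j₁ n ≤ ν j n ∧ ν j₂ n ≤ ν j n)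
    (hdecay : ∀ j, ∃ j', ∃ c : ℕ → ℝ≥0, Tendsto c atTop (𝓝 0) ∧ ∀ n, ν j n ≤ c n * ν j' n)
    (hν : ∃ j, 0 < ν j 0) : IsLinearisation ν hν Ω p := by
  let S := LinearEquiv.ofBijective (evalDelta (Ω := Ω) hpos hp)
    ⟨injective_evalDelta hpos hp hdir, surjective_evalDelta hpos hdecay hp hE hdir⟩
  have hS : Continuous S.symm := by
    refine continuous_of_tendsto_nhds_zero S.symm ?_
    rw [UniformConvergenceCLM.nhds_zero_eq_of_basis (RingHom.id 𝕜) E _ hp.hasBasis_zero_ball]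
    simp only [tendsto_iInf, tendsto_principal]
    rintro H hH ⟨s, r⟩ hr
    -- One seminorm dominates the equicontinuous set `H`, so `seminorm_apply_le` bounds the values
    -- on all of `H` at once.
    obtain ⟨q, hq, hqH⟩ := equicontinuous_iff_exists_seminorm.1 hH
    obtain ⟨K, j, C, hC, hqC⟩ := exists_bound_seminorm hdir q hq
    have hev : ∀ α ∈ s, ∀ᶠ f in 𝓝 (0 : WeightedSpace 𝕜 Ω ν p),
        C * WeightedSpace.seminorm 𝕜 Ω ν p K j α f < r := fun α _ => by
      have hc : Continuous fun f : WeightedSpace 𝕜 Ω ν p =>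
          C * WeightedSpace.seminorm 𝕜 Ω ν p K j α f := continuous_const.mul
        ((WeightedSpace.withSeminorms 𝕜 Ω ν p).continuous_seminorm (K, j, α))
      exact (isOpen_lt hc continuous_const).mem_nhds (by simpa using hr)
    filter_upwards [(Finset.eventually_all s).2 hev] with f hf y hy
    rw [Seminorm.mem_ball_zero]
    refine Seminorm.finset_sup_apply_lt hr fun α hα => lt_of_le_of_lt ?_ (hf α hα)
    have h1 := seminorm_apply_le hpos hp (S.symm f) hC (fun g => (hqH y hy g).trans (hqC g)) α
    have h2 : evalDelta hpos hp (S.symm f) = f := S.apply_symm_apply f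
    rwa [h2] at h1
  exact ⟨⟨S, continuous_evalDelta hpos hp, hS⟩, fun u x => rfl⟩

end Linearisation

/-! ### Directedness and decay of the Beurling and Roumieu weights -/

section Weights

variable {M : ℕ → ℝ≥0}

theorem one_div_le_of_le {a b m : ℝ≥0} (ha : 0 < a) (hm : 0 < m) (h : a ≤ b) :
    1 / (b * m) ≤ 1 / (a * m) :=
  one_div_le_one_div_of_le (mul_pos ha hm) (mul_le_mul_left h m)

theorem beurlingWeight_directed (hM : ∀ n, 0 < M n) (h₁ h₂ : BeurlingIndex) :
    ∃ h, ∀ n, beurlingWeight M h₁ n ≤ beurlingWeight M h n ∧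
      beurlingWeight M h₂ n ≤ beurlingWeight M h n := by
  have h0 : 0 < min h₁.1 h₂.1 := lt_min h₁.2 h₂.2
  exact ⟨⟨_, h0⟩, fun n =>
    ⟨one_div_le_of_le (pow_pos h0 n) (hM n) (pow_le_pow_left₀ h0.le (min_le_left _ _) n),
      one_div_le_of_le (pow_pos h0 n) (hM n) (pow_le_pow_left₀ h0.le (min_le_right _ _) n)⟩⟩

theorem beurlingWeight_decay (h : BeurlingIndex) :
    ∃ h', ∃ c : ℕ → ℝ≥0, Tendsto c atTop (𝓝 0) ∧
      ∀ n, beurlingWeight M h n ≤ c n * beurlingWeight M h' n := by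
  -- Halving `h` multiplies the weight of order `n` by `2 ^ n`.
  refine ⟨⟨h.1 / 2, half_pos h.2⟩, fun n => (1 / 2) ^ n,
    NNReal.tendsto_pow_atTop_nhds_zero_of_lt_one (by
      rw [← NNReal.coe_lt_coe]
      norm_num), fun n => le_of_eq ?_⟩
  have := h.2.ne'
  simp only [beurlingWeight, div_pow, one_pow]
  field_simp

theorem roumieuWeight_directed (hM : ∀ n, 0 < M n) (h₁ h₂ : RoumieuIndex) :
    ∃ h, ∀ n, roumieuWeight M h₁ n ≤ roumieuWeight M h n ∧
      roumieuWeight M h₂ n ≤ roumieuWeight M h n := by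
  have h0 : ∀ k, 0 < min (h₁.1 k) (h₂.1 k) := fun k => lt_min (h₁.2.1 k) (h₂.2.1 k)
  refine ⟨⟨fun k => min (h₁.1 k) (h₂.1 k), h0, h₁.2.2.1.min h₂.2.2.1,
    tendsto_atTop.2 fun b => ?_⟩, fun n => ⟨?_, ?_⟩⟩
  · filter_upwards [tendsto_atTop.1 h₁.2.2.2 b, tendsto_atTop.1 h₂.2.2.2 b] with k hk hk'
      using le_min hk hk'
  · exact one_div_le_of_le (Finset.prod_pos fun k _ => h0 k) (hM n)
      (Finset.prod_le_prod' fun k _ => min_le_left _ _)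
  · exact one_div_le_of_le (Finset.prod_pos fun k _ => h0 k) (hM n)
      (Finset.prod_le_prod' fun k _ => min_le_right _ _)

/-- From some index on the factors are at most `1 / 2`, so the products decay geometrically. -/
theorem tendsto_prod_zero {c : ℕ → ℝ≥0} (hc : Tendsto c atTop (𝓝 0)) :
    Tendsto (fun n => ∏ k ∈ Finset.range n, c k) atTop (𝓝 0) := by
  obtain ⟨N, hN⟩ := eventually_atTop.1 (hc.eventually_le_const (show (0 : ℝ≥0) < 1 / 2 by simp))
  have hbound : ∀ m, ∏ k ∈ Finset.range (m + N), c k ≤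
      (1 / 2) ^ m * ∏ k ∈ Finset.range N, c k := by
    intro m
    induction m with
    | zero => simp
    | succ m ih =>
      rw [Nat.add_right_comm, Finset.prod_range_succ, pow_succ, mul_right_comm]
      exact mul_le_mul' ih (hN _ (Nat.le_add_left _ _))
  rw [← tendsto_add_atTop_iff_nat N]
  refine tendsto_of_tendsto_of_tendsto_of_le_of_le tendsto_const_nhds ?_ (fun _ => zero_le) hbound
  have h1 : Tendsto (fun m : ℕ => ((1 : ℝ≥0) / 2) ^ m) atTop (𝓝 0) :=
    NNReal.tendsto_pow_atTop_nhds_zero_of_lt_one (by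
      rw [← NNReal.coe_lt_coe]
      norm_num)
  simpa using h1.mul_const (∏ k ∈ Finset.range N, c k)

theorem roumieuWeight_decay (h : RoumieuIndex) :
    ∃ h', ∃ c : ℕ → ℝ≥0, Tendsto c atTop (𝓝 0) ∧
      ∀ n, roumieuWeight M h n ≤ c n * roumieuWeight M h' n := by
  have hs : Tendsto (fun k => NNReal.sqrt (h.1 k)) atTop atTop := by
    refine tendsto_atTop.2 fun b => ?_
    filter_upwards [tendsto_atTop.1 h.2.2.2 (b ^ 2)] with k hk
    rwa [NNReal.le_sqrt_iff_sq_le]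
  have hpos : ∀ k, 0 < NNReal.sqrt (h.1 k) := fun k => NNReal.sqrt_pos.2 (h.2.1 k)
  -- Square roots still increase to infinity, and `h_k` is the product of two of them: one stays in
  -- the new weight, the inverse of the other goes into `c n`.
  refine ⟨⟨fun k => NNReal.sqrt (h.1 k), hpos, fun a b hab => NNReal.sqrt_le_sqrt.2 (h.2.2.1 hab),
    hs⟩, fun n => ∏ k ∈ Finset.range n, (NNReal.sqrt (h.1 k))⁻¹,
    tendsto_prod_zero (tendsto_inv_atTop_zero.comp hs), fun n => le_of_eq ?_⟩
  have e : ∏ k ∈ Finset.range n, h.1 k =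
      (∏ k ∈ Finset.range n, NNReal.sqrt (h.1 k)) * ∏ k ∈ Finset.range n, NNReal.sqrt (h.1 k) := by
    rw [← Finset.prod_mul_distrib]
    exact Finset.prod_congr rfl fun k _ => (NNReal.mul_self_sqrt _).symm
  change 1 / ((∏ k ∈ Finset.range n, h.1 k) * M n) = (∏ k ∈ Finset.range n, (NNReal.sqrt (h.1 k))⁻¹) *
    (1 / ((∏ k ∈ Finset.range n, NNReal.sqrt (h.1 k)) * M n))
  rw [e, Finset.prod_inv_distrib, mul_assoc, one_div, mul_inv, one_div]

theorem beurlingWeight_pos' (hM : ∀ n, 0 < M n) (h : BeurlingIndex) (n : ℕ) :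
    0 < beurlingWeight M h n :=
  one_div_pos.2 (mul_pos (pow_pos h.2 n) (hM n))

theorem roumieuWeight_pos' (hM : ∀ n, 0 < M n) (h : RoumieuIndex) (n : ℕ) :
    0 < roumieuWeight M h n :=
  one_div_pos.2 (mul_pos (Finset.prod_pos fun k _ => h.2.1 k) (hM n))

end Weights

end Ultra

end

/-! ### The theorem for both classes -/

theorem mainTheorem9 {𝕜 : Type*} [RCLike 𝕜] {E : Type*} [AddCommGroup E] [Module 𝕜 E]
    [UniformSpace E] [IsUniformAddGroup E] [ContinuousSMul 𝕜 E] [T2Space E]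
    {A : Type*} (p : SeminormFamily 𝕜 E A) (hp : WithSeminorms p)
    {d : ℕ} (Ω : TopologicalSpace.Opens (EuclideanSpace ℝ (Fin d)))
    (M : ℕ → NNReal) (hM : ∀ n, 0 < M n) :
    ((CompleteSpace E ∨ Ultra.IsSemiMontel 𝕜 E) →
      Ultra.IsLinearisation (Ultra.beurlingWeight M) (Ultra.beurlingWeight_pos hM) Ω p) ∧
    ((CompleteSpace E ∨ Ultra.IsSemiMontel 𝕜 E) → Ultra.CondM1 M → Ultra.CondM3' M →
      Ultra.IsLinearisation (Ultra.roumieuWeight M) (Ultra.roumieuWeight_pos hM) Ω p) ∧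
    (Ultra.IsSeqComplete E →
      Ultra.CondM0 M → Ultra.CondM1 M → Ultra.CondM2' M → Ultra.CondM3' M →
      Ultra.IsLinearisation (Ultra.beurlingWeight M) (Ultra.beurlingWeight_pos hM) Ω p ∧
      Ultra.IsLinearisation (Ultra.roumieuWeight M) (Ultra.roumieuWeight_pos hM) Ω p) := by
  have hseq : CompleteSpace E ∨ Ultra.IsSemiMontel 𝕜 E → Ultra.IsSeqComplete E := by
    rintro (h | h)
    · exact Ultra.isSeqComplete_of_completeSpace
    · exact h.isSeqComplete
  have hB : Ultra.IsSeqComplete E →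
      Ultra.IsLinearisation (Ultra.beurlingWeight M) (Ultra.beurlingWeight_pos hM) Ω p := fun hE =>
    have : Nonempty Ultra.BeurlingIndex := ⟨(Ultra.beurlingWeight_pos hM).choose⟩
    Ultra.isLinearisation_of_isSeqComplete hp hE (Ultra.beurlingWeight_pos' hM)
      (Ultra.beurlingWeight_directed hM) Ultra.beurlingWeight_decay _
  have hR : Ultra.IsSeqComplete E →
      Ultra.IsLinearisation (Ultra.roumieuWeight M) (Ultra.roumieuWeight_pos hM) Ω p := fun hE =>
    have : Nonempty Ultra.RoumieuIndex := ⟨(Ultra.roumieuWeight_pos hM).choose⟩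
    Ultra.isLinearisation_of_isSeqComplete hp hE (Ultra.roumieuWeight_pos' hM)
      (Ultra.roumieuWeight_directed hM) Ultra.roumieuWeight_decay _
  exact ⟨fun h => hB (hseq h), fun h _ _ => hR (hseq h), fun h _ _ _ _ => ⟨hB h, hR h⟩⟩
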